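/- Let $0<l<\infty$, let $q\in L^2(0,l)$ be real-valued, and for $\lambda\in\mathbb C$, $p=0,1,2$, let $s_p(\lambda,x)$ be the solution on $[0,l]$ of $iy'''+qy=\lambda^3y$ with $y^{(j)}(0)=\delta_{jp}$ ($j=0,1,2$). For $\theta\in\mathbb T$ and $h\in\mathbb R$ let $$\Delta_\theta(q,\lambda)=s_2(\lambda,l)s_1'(\lambda,l)-s_1(\lambda,l)s_2'(\lambda,l)-\theta s_2(\lambda,l),$$ $$\Delta_{\theta,h}(q,\lambda)=\det\begin{bmatrix}1&0&-ih\\ s_0'(\lambda,l)&s_1'(\lambda,l)-\theta&s_2'(\lambda,l)\\ s_0(\lambda,l)&s_1(\lambda,l)&s_2(\lambda,l)\end{bmatrix}$$ (the characteristic functions of $iD^3+q$ with the boundary conditions $y'(l)=\theta y'(0)$, $y(l)=0$ and, respectively, $y(0)=0$ or $y(0)=ihy''(0)$). Let $\{\lambda_n(q,\theta)\}$ and $\{\lambda_n(q,\theta,h)\}$ be the sets of their real zeros, put $a=s_2(0,l)$, $b=s_0(0,l)$, $\theta_0=\overline a/a$, $\theta_1=\overline b/b$, and define the spectral sets $$\mathfrak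 A_\theta=(a;\theta;\{\lambda_n(q,\theta)\}),\qquad \mathfrak A_{\theta,h}=(a;b;\theta;h;\{\lambda_n(q,\theta,h)\}).$$ Let $\theta,\widehat\theta\in\mathbb T$, $\theta\ne\widehat\theta$, $h\in\mathbb R$, $h\neq0$, and assume that for $\tau=\theta$ and for $\tau=\widehat\theta$ $$a\ne0,\qquad \tau+\theta_0\neq0,\qquad a(\tau+\theta_0)+ihb(\tau-\theta_1)\ne0 .$$ Then the four spectral sets $\mathfrak A_\theta,\mathfrak A_{\widehat\theta},\mathfrak A_{\theta,h},\mathfrak A_{\widehat\theta,h}$ uniquely determine the functions $s_2(\lambda,l)$ and $s_0(\lambda,l)$ of $\lambda\in\mathbb C$: if a second real potential in $L^2(0,l)$ has the same four spectral sets, then its functions $s_2(\lambda,l)$ and $s_0(\lambda,l)$ are the same. Explicitly, for every $\lambda\in\mathbb C$ and $\tau\in\{\theta,\widehat\theta\}$ the following products converge unconditionally and $$\Delta_\tau(q,\lambda)=-a(\tau+\theta_0)\prod_n\Bigl(1-\frac{\lambda^3}{\lambda_n^3(q,\tau)}\Bigr),\qquad \Delta_{\tau,h}(q,\lambda)=-\{a(\tau+\theta_0)+ihb(\tau-\theta_1)\}\prod_n\Bigl(1-\frac{\lambda^3}{\lambda_n^3(q,\tau,h)}\Bigr),$$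 and, with $\Pi(\tau)=a\prod_n\bigl(1-\lambda^3/\lambda_n^3(q,\tau)\bigr)$, $$s_2(\lambda,l)=\frac1{\theta-\widehat\theta}\bigl\{\Pi(\theta)(\theta+\theta_0)-\Pi(\widehat\theta)(\widehat\theta+\theta_0)\bigr\},$$ $$s_0(\lambda,l)=\frac1{ih(\theta-\widehat\theta)}\bigl\{\Delta_\theta(q,\lambda)-\Delta_{\widehat\theta}(q,\lambda)-\Delta_{\theta,h}(q,\lambda)+\Delta_{\widehat\theta,h}(q,\lambda)\bigr\},$$ where the functions $\Delta$ in the last formula are those given by the products, i.e. constructed from the spectral sets. -/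

import Mathlib

open Complex MeasureTheory Set

noncomputable section

namespace ThirdOrder

/-- `Y 0` is the solution `y` on `[0, l]` of the Cauchy problem
`i y''' + q y = lam ^ 3 y`, `y(0) = c 0`, `y'(0) = c 1`, `y''(0) = c 2`,
and `Y 1 = y'`, `Y 2 = y''`.  The equation is integrated once: `y''` is absolutely
continuous and `i y''' = (lam ^ 3 - q) y` almost everywhere. -/
structure IsCauchySolution (q : ℝ → ℝ) (l : ℝ) (lam : ℂ) (c : Fin 3 → ℂ)
    (Y : Fin 3 → ℝ → ℂ) : Prop where
  deriv_zero : ∀ x ∈ Icc 0 l, HasDerivWithinAt (Y 0) (Y 1 x) (Icc 0 l) x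
  deriv_one : ∀ x ∈ Icc 0 l, HasDerivWithinAt (Y 1) (Y 2 x) (Icc 0 l) x
  equation : ∀ x ∈ Icc 0 l,
    I * (Y 2 x - c 2) = ∫ t in (0 : ℝ)..x, (lam ^ 3 - (q t : ℂ)) * Y 0 t
  init_zero : Y 0 0 = c 0
  init_one : Y 1 0 = c 1

/-- The solution (with its first two derivatives) of the Cauchy problem with initial data
`y⁽ʲ⁾(0) = δ_{jp}`; it exists and is unique on `[0, l]` for `q ∈ L²(0, l)`. -/
def fundSol (q : ℝ → ℝ) (l : ℝ) (p : Fin 3) (lam : ℂ) : Fin 3 → ℝ → ℂ :=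
  Classical.epsilon (IsCauchySolution q l lam (Pi.single p 1))

/-- `s_p(lam, l)`. -/
def s (q : ℝ → ℝ) (l : ℝ) (p : Fin 3) (lam : ℂ) : ℂ := fundSol q l p lam 0 l

/-- `s_p'(lam, l)`, the derivative in `x` at `x = l`. -/
def s' (q : ℝ → ℝ) (l : ℝ) (p : Fin 3) (lam : ℂ) : ℂ := fundSol q l p lam 1 l

/-- Characteristic function of `i D³ + q` with
`y(0) = 0`, `y'(l) = θ y'(0)`, `y(l) = 0`. -/
def charFun (q : ℝ → ℝ) (l : ℝ) (θ : ℂ) (lam : ℂ) : ℂ :=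
  s q l 2 lam * s' q l 1 lam - s q l 1 lam * s' q l 2 lam - θ * s q l 2 lam

/-- Characteristic function of `i D³ + q` with
`y(0) = i h y''(0)`, `y'(l) = θ y'(0)`, `y(l) = 0`. -/
def charFunH (q : ℝ → ℝ) (l : ℝ) (θ : ℂ) (h : ℝ) (lam : ℂ) : ℂ :=
  Matrix.det !![1, 0, -I * h;
    s' q l 0 lam, s' q l 1 lam - θ, s' q l 2 lam;
    s q l 0 lam, s q l 1 lam, s q l 2 lam]

/-- Data `(a; θ; {λ_n})`. -/
@[ext]
structure SpectralSet where
  a : ℂ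
  θ : ℂ
  zeros : Set ℝ

/-- Data `(a; b; θ; h; {λ_n})`. -/
@[ext]
structure SpectralSetH where
  a : ℂ
  b : ℂ
  θ : ℂ
  h : ℝ
  zeros : Set ℝ

/-- The spectral set `𝔄_θ` of the potential `q`: `a = s₂(0, l)` and the `λ_n` are the real
zeros of the characteristic function. -/
def spectralSet (q : ℝ → ℝ) (l : ℝ) (θ : ℂ) : SpectralSet where
  a := s q l 2 0
  θ := θ
  zeros := {μ : ℝ | charFun q l θ μ = 0}

/-- The spectral set `𝔄_{θ,h}` of the potential `q`: `a = s₂(0, l)`, `b = s₀(0, l)` and the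
`λ_n` are the real zeros of the characteristic function. -/
def spectralSetH (q : ℝ → ℝ) (l : ℝ) (θ : ℂ) (h : ℝ) : SpectralSetH where
  a := s q l 2 0
  b := s q l 0 0
  θ := θ
  h := h
  zeros := {μ : ℝ | charFunH q l θ h μ = 0}

/-- `z̄ / z`, so that `θ₀ = phase a` and `θ₁ = phase b`. -/
def phase (z : ℂ) : ℂ := (starRingEnd ℂ) z / z

/-- `a ≠ 0`, `θ + θ₀ ≠ 0`, `a (θ + θ₀) + i h b (θ - θ₁) ≠ 0`. -/
def SpectralSetH.Admissible (A : SpectralSetH) : Prop :=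
  A.a ≠ 0 ∧ A.θ + phase A.a ≠ 0 ∧
    A.a * (A.θ + phase A.a) + I * A.h * A.b * (A.θ - phase A.b) ≠ 0

/-- The factor `1 - lam³ / μ³`. -/
def factor (lam : ℂ) (μ : ℝ) : ℂ := 1 - lam ^ 3 / (μ : ℂ) ^ 3

/-- `Π(θ) = a ∏_n (1 - lam³ / λ_n³)`. -/
def SpectralSet.prodFun (A : SpectralSet) (lam : ℂ) : ℂ :=
  A.a * ∏' μ : A.zeros, factor lam μ

/-- The function `Δ_θ` constructed from the data `𝔄_θ`. -/
def SpectralSet.delta (A : SpectralSet) (lam : ℂ) : ℂ :=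
  -(A.a * (A.θ + phase A.a)) * ∏' μ : A.zeros, factor lam μ

/-- The function `Δ_{θ,h}` constructed from the data `𝔄_{θ,h}`. -/
def SpectralSetH.delta (A : SpectralSetH) (lam : ℂ) : ℂ :=
  -(A.a * (A.θ + phase A.a) + I * A.h * A.b * (A.θ - phase A.b)) *
    ∏' μ : A.zeros, factor lam μ

/-- The right-hand side of the formula for `s₂(lam, l)`, built from two spectral sets. -/
def recoverS2 (A B : SpectralSet) (lam : ℂ) : ℂ :=
  1 / (A.θ - B.θ) *
    (A.prodFun lam * (A.θ + phase A.a) - B.prodFun lam * (B.θ + phase B.a))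

/-- The right-hand side of the formula for `s₀(lam, l)`, built from four spectral sets. -/
def recoverS0 (A B : SpectralSet) (AH BH : SpectralSetH) (lam : ℂ) : ℂ :=
  1 / (I * AH.h * (A.θ - B.θ)) *
    (A.delta lam - B.delta lam - AH.delta lam + BH.delta lam)

end ThirdOrder

end

/-!
With `z = λ³`, let `U(z) = s₂(λ, l) + i h s₀(λ, l)`, the value at `l` of a solution with
`y(0) = i h y''(0)`. The conjugated wedge product of two solutions solves the equation with the
conjugate spectral parameter, which gives `Δ_{θ,h} = -(conj (U (conj z)) + θ U(z))`, and `h = 0`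
gives `Δ_θ`. Lagrange's identity for the combination of the solutions with `y(0) = i h y''(0)` that
vanishes at `l` exhibits `U(z) conj(U(w)) - conj(U(conj z)) U(conj w)` as `-i (z - conj w)` times a
Gram kernel, and a monotonicity argument shows that `U` has no zeros in the closed upper half-plane.
Hence for `|θ| = 1` the zeros of `conj (U (conj z)) + θ U(z)` are real and simple. This function has
order `1 / 3` in `z`, so it is its value at `0` times the canonical product of genus zero over its
zeros. The characteristic functions are thus given by the products, and they are affine in `θ` and
in `h` with coefficients that reveal `s₂` and `s₀`.
-/

noncomputable section

namespace ThirdOrder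

open Filter Topology Metric Asymptotics
open scoped ComplexConjugate

/-- Order at most `ρ` and finite type: `f z = O(exp (B |z| ^ ρ))` on the whole plane. -/
def HasExpGrowth {E : Type*} [Norm E] (ρ : ℝ) (f : ℂ → E) : Prop :=
  ∃ B : ℝ, f =O[⊤] fun z => Real.exp (B * ‖z‖ ^ ρ)

section Growth

variable {f g : ℂ → ℂ} {ρ : ℝ}

lemma HasExpGrowth.exists_norm_le (hf : HasExpGrowth ρ f) :
    ∃ D B : ℝ, 0 < D ∧ 0 ≤ B ∧ ∀ z, ‖f z‖ ≤ Real.exp (D + B * ‖z‖ ^ ρ) := by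
  obtain ⟨B, hB⟩ := hf
  obtain ⟨C, hC, hCB⟩ := hB.exists_pos
  rw [isBigOWith_top] at hCB
  refine ⟨C, |B|, hC, abs_nonneg B, fun z => (hCB z).trans ?_⟩
  rw [Real.norm_eq_abs, Real.abs_exp, Real.exp_add]
  have hC' : C ≤ Real.exp C := by linarith [Real.add_one_le_exp C]
  gcongr
  exact le_abs_self B

lemma HasExpGrowth.const_mul (hf : HasExpGrowth ρ f) (c : ℂ) :
    HasExpGrowth ρ fun z => c * f z :=
  let ⟨B, hB⟩ := hf
  ⟨B, hB.const_mul_left c⟩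

lemma HasExpGrowth.add (hf : HasExpGrowth ρ f) (hg : HasExpGrowth ρ g) :
    HasExpGrowth ρ fun z => f z + g z := by
  obtain ⟨B, hB⟩ := hf
  obtain ⟨C, hC⟩ := hg
  refine ⟨max B C, IsBigO.add (hB.trans ?_) (hC.trans ?_)⟩ <;>
    refine isBigO_of_le _ fun z => ?_ <;>
    rw [Real.norm_eq_abs, Real.norm_eq_abs, Real.abs_exp, Real.abs_exp] <;>
    gcongr
  exacts [le_max_left B C, le_max_right B C]

lemma HasExpGrowth.conj_conj (hf : HasExpGrowth ρ f) :
    HasExpGrowth ρ fun z => conj (f (conj z)) := by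
  obtain ⟨B, hB⟩ := hf
  obtain ⟨C, hC⟩ := isBigO_top.1 hB
  exact ⟨B, isBigO_top.2 ⟨C, fun z => by simpa only [norm_conj] using hC (conj z)⟩⟩

end Growth

lemma exists_exp_eqOn_ball {f : ℂ → ℂ} {c : ℂ} {r : ℝ} (hf : DifferentiableOn ℂ f (ball c r))
    (hf0 : ∀ z ∈ ball c r, f z ≠ 0) (hr : 0 < r) :
    ∃ L : ℂ → ℂ, DifferentiableOn ℂ L (ball c r) ∧ L c = log (f c) ∧
      EqOn f (fun z => exp (L z)) (ball c r) := by
  have hc : c ∈ ball c r := mem_ball_self hr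
  obtain ⟨L, hLc, hL⟩ :=
    ((hf.deriv isOpen_ball).div hf hf0).isExactOn_ball.with_val_at c (log (f c))
  have hLd : DifferentiableOn ℂ L (ball c r) := fun z hz =>
    (hL z hz).differentiableAt.differentiableWithinAt
  have hlog : EqOn (logDeriv f) (logDeriv fun z => exp (L z)) (ball c r) := fun z hz => by
    rw [logDeriv_apply, logDeriv_apply, (hL z hz).cexp.deriv,
      mul_div_cancel_left₀ _ (exp_ne_zero _)]
    rfl
  obtain ⟨k, -, hk⟩ := (logDeriv_eqOn_iff hf hLd.cexp isOpen_ball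
    (convex_ball c r).isPreconnected (fun _ _ => exp_ne_zero _) hf0).1 hlog
  have hk1 : k = 1 := by
    have h := hk hc
    rw [Pi.smul_apply, hLc, exp_log (hf0 c hc), smul_eq_mul] at h
    exact (mul_eq_right₀ (hf0 c hc)).1 h.symm
  exact ⟨L, hLd, hLc, by simpa only [hk1, one_smul] using hk⟩

lemma exists_eq_prod_mul {f : ℂ → ℂ} (hf : Differentiable ℂ f) (h0 : f 0 ≠ 0)
    (S : Finset ℂ) (hS : ∀ a ∈ S, f a = 0) :
    ∃ g : ℂ → ℂ, Differentiable ℂ g ∧ ∀ z, f z = (∏ a ∈ S, (1 - z / a)) * g z := by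
  classical
  induction S using Finset.induction_on with
  | empty => exact ⟨f, hf, by simp⟩
  | insert a S ha ih =>
    obtain ⟨g, hg, hfg⟩ := ih fun b hb => hS b (Finset.mem_insert_of_mem hb)
    have hne : ∀ b ∈ insert a S, b ≠ 0 := by
      rintro b hb rfl
      exact h0 (hS _ hb)
    have hga : g a = 0 := by
      have hprod : ∏ b ∈ S, (1 - a / b) ≠ 0 := Finset.prod_ne_zero_iff.2 fun b hb h => by
        have hb0 : b ≠ 0 := hne b (Finset.mem_insert_of_mem hb)
        rw [sub_eq_zero, eq_comm, div_eq_one_iff_eq hb0] at h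
        exact ha (h ▸ hb)
      have hfa := hfg a
      rw [hS a (Finset.mem_insert_self _ _)] at hfa
      exact (mul_eq_zero.1 hfa.symm).resolve_left hprod
    refine ⟨fun z => -a * dslope g a z, ?_, fun z => ?_⟩
    · have : Differentiable ℂ (dslope g a) := by
        rw [← differentiableOn_univ]
        exact (differentiableOn_dslope univ_mem).2 hg.differentiableOn
      fun_prop
    · have hslope : (z - a) * dslope g a z = g z := by
        simpa [hga] using sub_smul_dslope g a z
      have ha0 : a ≠ 0 := hne a (Finset.mem_insert_self _ _)
      rw [Finset.prod_insert ha, hfg z, ← hslope]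
      field_simp
      ring

/-- On the circle of radius `4 R` each factor has modulus at least `3`. -/
lemma three_pow_card_mul_norm_le {g : ℂ → ℂ} (hg : Differentiable ℂ g) {S : Finset ℂ} {R M : ℝ}
    (hR : 0 < R) (hS : ∀ a ∈ S, a ≠ 0 ∧ ‖a‖ ≤ R)
    (hM : ∀ w, ‖w‖ = 4 * R → ‖(∏ a ∈ S, (1 - w / a)) * g w‖ ≤ M) {z : ℂ} (hz : ‖z‖ ≤ R) :
    3 ^ S.card * ‖g z‖ ≤ M := by
  have hcircle : ∀ w ∈ frontier (ball (0 : ℂ) (4 * R)), ‖(3 : ℂ) ^ S.card * g w‖ ≤ M := by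
    intro w hw
    rw [frontier_ball _ (by positivity), mem_sphere_zero_iff_norm] at hw
    have hfactor : ∀ a ∈ S, 3 ≤ ‖1 - w / a‖ := fun a ha => by
      have hquot : 4 ≤ ‖w / a‖ := by
        rw [norm_div, hw, le_div_iff₀ (norm_pos_iff.2 (hS a ha).1)]
        linarith [(hS a ha).2]
      have := norm_sub_norm_le (w / a) 1
      rw [norm_sub_rev, norm_one] at this
      linarith
    refine le_trans ?_ (hM w hw)
    rw [norm_mul, norm_mul, norm_pow, norm_prod, ← Finset.prod_const]
    gcongr with a ha
    simpa using hfactor a ha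
  have hmax := norm_le_of_forall_mem_frontier_norm_le isBounded_ball
    (hg.const_mul ((3 : ℂ) ^ S.card)).diffContOnCl hcircle (z := z)
    (by rw [closure_ball _ (by positivity), mem_closedBall_zero_iff]; linarith)
  simpa using hmax

lemma summable_inv_of_card_le {α : Type*} {r : α → ℝ} {C ρ : ℝ} (hr : ∀ a, 0 < r a)
    (hC : 0 ≤ C) (hρ : 0 < ρ) (hρ1 : ρ < 1)
    (hcard : ∀ (s : Finset α), ∀ a ∈ s, (∀ b ∈ s, r b ≤ r a) → (s.card : ℝ) ≤ C * r a ^ ρ) :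
    Summable fun a => (r a)⁻¹ := by
  classical
  have hsum : Summable fun n : ℕ => (C / (n + 1 : ℕ)) ^ ρ⁻¹ := by
    have hp := (summable_nat_add_iff 1).2 (Real.summable_nat_rpow_inv.2 (one_lt_inv₀ hρ |>.2 hρ1))
    refine (hp.mul_left (C ^ ρ⁻¹)).congr fun n => ?_
    rw [Real.div_rpow hC (Nat.cast_nonneg _), div_eq_mul_inv]
  have hnonneg : ∀ n : ℕ, 0 ≤ (C / (n + 1 : ℕ)) ^ ρ⁻¹ := fun n => by positivity
  refine summable_of_sum_le (fun a => (inv_pos.2 (hr a)).le) (fun s => ?_)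
    (c := ∑' n : ℕ, (C / (n + 1 : ℕ)) ^ ρ⁻¹)
  -- In increasing order of `r`, the `n`-th term is at most `(C / n) ^ (1 / ρ)`.
  have hordered : ∑ a ∈ s, (r a)⁻¹ ≤ ∑ n ∈ Finset.range s.card, (C / (n + 1 : ℕ)) ^ ρ⁻¹ := by
    induction s using Finset.induction_on_max_value r with
    | empty => simp
    | insert a s ha hmax ih =>
      rw [Finset.sum_insert ha, Finset.card_insert_of_notMem ha, Finset.sum_range_succ, add_comm]
      gcongr
      have hlast := hcard (insert a s) a (Finset.mem_insert_self a s) fun b hb =>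
        (Finset.mem_insert.1 hb).elim (fun h => h ▸ le_rfl) (hmax b)
      rw [Finset.card_insert_of_notMem ha] at hlast
      have hpos := hr a
      rw [Real.le_rpow_inv_iff_of_pos (by positivity) (by positivity) hρ,
        Real.inv_rpow hpos.le, inv_le_iff_one_le_mul₀ (by positivity), div_mul_eq_mul_div,
        one_le_div (by positivity)]
      exact hlast
  exact hordered.trans (hsum.sum_le_tsum _ fun n _ => hnonneg n)

section Zeros

variable {f : ℂ → ℂ} {ρ B D : ℝ}

lemma card_zeros_le (hf : Differentiable ℂ f) (h0 : f 0 = 1)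
    (hgr : ∀ z, ‖f z‖ ≤ Real.exp (D + B * ‖z‖ ^ ρ)) {R : ℝ} (hR : 0 < R) {S : Finset ℂ}
    (hS : ∀ a ∈ S, f a = 0 ∧ ‖a‖ ≤ R) : (S.card : ℝ) ≤ D + B * (4 * R) ^ ρ := by
  obtain ⟨g, hg, hfg⟩ := exists_eq_prod_mul hf (h0 ▸ one_ne_zero) S fun a ha => (hS a ha).1
  have hg0 : g 0 = 1 := by simpa [h0] using (hfg 0).symm
  have hS0 : ∀ a ∈ S, a ≠ 0 := by
    rintro a ha rfl
    simpa [h0] using (hS 0 ha).1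
  have hthree : (3 : ℝ) ^ S.card ≤ Real.exp (D + B * (4 * R) ^ ρ) := by
    simpa [hg0] using three_pow_card_mul_norm_le hg hR (fun a ha => ⟨hS0 a ha, (hS a ha).2⟩)
      (fun w hw => by rw [← hfg, ← hw]; exact hgr w) (z := 0) (by simpa using hR.le)
  have hexp : Real.exp (S.card : ℝ) ≤ 3 ^ S.card := by
    rw [← Real.exp_one_pow]
    exact pow_le_pow_left₀ (Real.exp_pos _).le (by linarith [Real.exp_one_lt_d9]) _
  exact Real.exp_le_exp.1 (hexp.trans hthree)

lemma finite_zeros_norm_le (hf : Differentiable ℂ f) (h0 : f 0 = 1)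
    (hgr : ∀ z, ‖f z‖ ≤ Real.exp (D + B * ‖z‖ ^ ρ)) (R : ℝ) :
    {a : ℂ | f a = 0 ∧ ‖a‖ ≤ R}.Finite := by
  by_contra hinf
  have hpos : 0 < max R 1 := by positivity
  obtain ⟨n, hn⟩ := exists_nat_gt (D + B * (4 * max R 1) ^ ρ)
  obtain ⟨S, hS, rfl⟩ := Set.Infinite.exists_subset_card_eq hinf n
  exact hn.not_ge (card_zeros_le hf h0 hgr hpos fun a ha =>
    ⟨(hS ha).1, (hS ha).2.trans (le_max_left R 1)⟩)

lemma summable_inv_norm_zeros (hf : Differentiable ℂ f) (h0 : f 0 = 1) (hρ : 0 < ρ)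
    (hρ1 : ρ < 1) (hB : 0 ≤ B) (hD : 0 ≤ D) (hgr : ∀ z, ‖f z‖ ≤ Real.exp (D + B * ‖z‖ ^ ρ)) :
    Summable fun a : {a : ℂ // f a = 0} => ‖(a : ℂ)‖⁻¹ := by
  obtain ⟨r, hr, hball⟩ : ∃ r > 0, ∀ a, f a = 0 → r ≤ ‖a‖ := by
    have hnear : ∀ᶠ z in 𝓝 (0 : ℂ), f z ≠ 0 :=
      hf.continuous.continuousAt.eventually_ne (by simp [h0])
    obtain ⟨r, hr, hne⟩ := Metric.eventually_nhds_iff.1 hnear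
    exact ⟨r, hr, fun a ha => not_lt.1 fun h => hne (by simpa using h) ha⟩
  have hpos : ∀ a : {a : ℂ // f a = 0}, 0 < ‖(a : ℂ)‖ := fun a => hr.trans_le (hball a a.2)
  refine summable_inv_of_card_le hpos (C := D / r ^ ρ + B * 4 ^ ρ) (by positivity) hρ hρ1
    fun s a _ hmax => ?_
  have hcard := card_zeros_le hf h0 hgr (hpos a) (S := s.map (Function.Embedding.subtype _))
    fun b hb => by
      obtain ⟨c, hc, rfl⟩ := Finset.mem_map.1 hb
      exact ⟨c.2, hmax c hc⟩
  rw [Finset.card_map, Real.mul_rpow (by norm_num) (norm_nonneg _)] at hcard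
  have hD' : D ≤ D / r ^ ρ * ‖(a : ℂ)‖ ^ ρ := by
    rw [div_mul_eq_mul_div, le_div_iff₀ (by positivity)]
    gcongr
    exact hball a a.2
  linarith

/-- For `ρ < 1` the bound on `L` tends to `0` as `R → ∞`. -/
lemma exists_eq_prod_mul_exp (hf : Differentiable ℂ f) (h0 : f 0 = 1) (hB : 0 ≤ B) (hD : 0 < D)
    (hgr : ∀ z, ‖f z‖ ≤ Real.exp (D + B * ‖z‖ ^ ρ))
    (hsimple : ∀ z, f z = 0 → deriv f z ≠ 0) {R : ℝ} (hR : 0 < R) {S : Finset ℂ}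
    (hS : ∀ a, a ∈ S ↔ f a = 0 ∧ ‖a‖ ≤ R) {z : ℂ} (hz : ‖z‖ < R) :
    ∃ L : ℂ, ‖L‖ ≤ 2 * (D + B * (4 * R) ^ ρ) * ‖z‖ / (R - ‖z‖) ∧
      f z = (∏ a ∈ S, (1 - z / a)) * exp L := by
  obtain ⟨g, hg, hfg⟩ :=
    exists_eq_prod_mul hf (h0 ▸ one_ne_zero) S fun a ha => ((hS a).1 ha).1
  have hg0 : g 0 = 1 := by simpa [h0] using (hfg 0).symm
  have hS0 : ∀ a ∈ S, a ≠ 0 := by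
    rintro a ha rfl
    simpa [h0] using ((hS 0).1 ha).1
  have hgne : ∀ w ∈ ball (0 : ℂ) R, g w ≠ 0 := by
    intro w hw hgw
    have hfw : f w = 0 := by rw [hfg, hgw, mul_zero]
    have hwS : w ∈ S := (hS w).2 ⟨hfw, (mem_ball_zero_iff.1 hw).le⟩
    have hP : Differentiable ℂ fun z => ∏ a ∈ S, (1 - z / a) := by fun_prop
    have hPw : ∏ a ∈ S, (1 - w / a) = 0 :=
      Finset.prod_eq_zero hwS (by rw [div_self (hS0 w hwS), sub_self])
    have hdouble := ((hP w).hasDerivAt.mul (hg w).hasDerivAt).deriv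
    rw [hgw, hPw, mul_zero, zero_mul, add_zero] at hdouble
    rw [show (fun z => ∏ a ∈ S, (1 - z / a)) * g = f from funext fun z => (hfg z).symm] at hdouble
    exact hsimple w hfw hdouble
  obtain ⟨L, hL, hL0, hgL⟩ := exists_exp_eqOn_ball hg.differentiableOn hgne hR
  have hre : MapsTo L (ball 0 R) {w | w.re ≤ D + B * (4 * R) ^ ρ} := fun w hw => by
    have hgw := three_pow_card_mul_norm_le hg hR (fun a ha => ⟨hS0 a ha, ((hS a).1 ha).2⟩)
      (M := Real.exp (D + B * (4 * R) ^ ρ)) (fun v hv => by rw [← hfg, ← hv]; exact hgr v)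
      (mem_ball_zero_iff.1 hw).le
    replace hgw := (le_mul_of_one_le_left (norm_nonneg _)
      (one_le_pow₀ (by norm_num : (1 : ℝ) ≤ 3))).trans hgw
    rw [hgL hw, norm_exp] at hgw
    exact Real.exp_le_exp.1 hgw
  have hzR : z ∈ ball (0 : ℂ) R := mem_ball_zero_iff.2 hz
  exact ⟨L z, borelCaratheodory_zero (by positivity) hL hre hR hzR (by rw [hL0, hg0, log_one]),
    by rw [hfg, hgL hzR]⟩

lemma tendsto_add_rpow_div_sub_atTop (hρ1 : ρ < 1) (t : ℝ) :
    Tendsto (fun R : ℝ => 2 * (D + B * (4 * R) ^ ρ) * t / (R - t)) atTop (𝓝 0) := by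
  have hinv : Tendsto (fun R : ℝ => R⁻¹) atTop (𝓝 0) := tendsto_inv_atTop_zero
  have hrpow : Tendsto (fun R : ℝ => R ^ (-(1 - ρ))) atTop (𝓝 0) :=
    tendsto_rpow_neg_atTop (by linarith)
  have hlim : Tendsto (fun R : ℝ =>
      2 * (D * R⁻¹ + B * 4 ^ ρ * R ^ (-(1 - ρ))) * t / (1 - t * R⁻¹)) atTop (𝓝 0) := by
    have hnum := ((((hinv.const_mul D).add (hrpow.const_mul (B * 4 ^ ρ))).const_mul 2).mul_const t)
    have hden := (hinv.const_mul t).const_sub 1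
    simpa [Pi.div_def] using hnum.div hden (by norm_num)
  refine hlim.congr' ?_
  filter_upwards [eventually_gt_atTop 0] with R hR
  rw [Real.mul_rpow (by norm_num) hR.le, neg_sub, Real.rpow_sub_one hR.ne']
  field_simp

lemma tendsto_prod_zeros_norm_le (hf : Differentiable ℂ f) (h0 : f 0 = 1) (hρ1 : ρ < 1)
    (hB : 0 ≤ B) (hD : 0 < D) (hgr : ∀ z, ‖f z‖ ≤ Real.exp (D + B * ‖z‖ ^ ρ))
    (hsimple : ∀ z, f z = 0 → deriv f z ≠ 0) (z : ℂ) :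
    Tendsto (fun R => ∏ a ∈ (finite_zeros_norm_le hf h0 hgr R).toFinset, (1 - z / a)) atTop
      (𝓝 (f z)) := by
  set P : ℝ → ℂ := fun R => ∏ a ∈ (finite_zeros_norm_le hf h0 hgr R).toFinset, (1 - z / a)
  have hlog : ∀ R : ℝ, ∃ L : ℂ, ‖z‖ < R →
      ‖L‖ ≤ 2 * (D + B * (4 * R) ^ ρ) * ‖z‖ / (R - ‖z‖) ∧ f z = P R * exp L := fun R => by
    by_cases hz : ‖z‖ < R
    · obtain ⟨L, hL⟩ := exists_eq_prod_mul_exp hf h0 hB hD hgr hsimple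
        ((norm_nonneg z).trans_lt hz) (fun a => (finite_zeros_norm_le hf h0 hgr R).mem_toFinset) hz
      exact ⟨L, fun _ => hL⟩
    · exact ⟨0, fun h => absurd h hz⟩
  choose L hL using hlog
  have hL0 : Tendsto L atTop (𝓝 0) := by
    refine squeeze_zero_norm' ?_ (tendsto_add_rpow_div_sub_atTop (D := D) (B := B) hρ1 ‖z‖)
    filter_upwards [eventually_gt_atTop ‖z‖] with R hR using (hL R hR).1
  have hexp : Tendsto (fun R => f z * exp (-L R)) atTop (𝓝 (f z)) := by
    simpa using (((continuous_exp.tendsto _).comp hL0.neg).const_mul (f z))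
  refine hexp.congr' ?_
  filter_upwards [eventually_gt_atTop ‖z‖] with R hR
  rw [(hL R hR).2, mul_assoc, ← exp_add, add_neg_cancel, exp_zero, mul_one]

/-- Hadamard factorization in genus zero, for simple zeros. -/
theorem hasProd_one_sub_div_zeros (hf : Differentiable ℂ f) (h0 : f 0 ≠ 0) (hρ : 0 < ρ)
    (hρ1 : ρ < 1) (hgr : HasExpGrowth ρ f) (hsimple : ∀ z, f z = 0 → deriv f z ≠ 0) (z : ℂ) :
    HasProd (fun a : {a : ℂ // f a = 0} => 1 - z / (a : ℂ)) (f z / f 0) := by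
  wlog h1 : f 0 = 1 generalizing f
  · have hiff : ∀ a, f a = 0 ↔ (f 0)⁻¹ * f a = 0 := fun a =>
      (mul_eq_zero_iff_left (inv_ne_zero h0)).symm
    have hnorm := this (hf.const_mul (f 0)⁻¹) (by simp [h0]) (hgr.const_mul _)
      (fun z hz => by
        rw [deriv_const_mul_field]
        exact mul_ne_zero (inv_ne_zero h0) (hsimple z ((hiff z).2 hz)))
      (inv_mul_cancel₀ h0)
    rw [inv_mul_cancel₀ h0, div_one, ← div_eq_inv_mul] at hnorm
    simpa only [Function.comp_def, Equiv.subtypeEquivRight_apply_coe] using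
      (Equiv.subtypeEquivRight hiff).hasProd_iff.2 hnorm
  obtain ⟨D, B, hD, hB, hgr⟩ := hgr.exists_norm_le
  have hmul : Multipliable fun a : {a : ℂ // f a = 0} => 1 - z / (a : ℂ) := by
    have := (summable_inv_norm_zeros hf h1 hρ hρ1 hB hD.le hgr).mul_left ‖z‖
    simpa only [sub_eq_add_neg] using
      multipliable_one_add_of_summable (by simpa [div_eq_mul_inv] using this)
  have hfin := finite_zeros_norm_le hf h1 hgr
  have hexhaust : Tendsto (fun R => (hfin R).toFinset.subtype fun a => f a = 0) atTop atTop :=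
    tendsto_atTop_finset_of_monotone
      (fun R R' hR a ha => by
        simp only [Finset.mem_subtype, Finite.mem_toFinset, mem_ofPred_eq] at ha ⊢
        exact ⟨ha.1, ha.2.trans hR⟩) fun a => ⟨‖(a : ℂ)‖, by simp [a.2]⟩
  have hprod : ∀ R, ∏ a ∈ (hfin R).toFinset.subtype fun a => f a = 0, (1 - z / (a : ℂ)) =
      ∏ a ∈ (hfin R).toFinset, (1 - z / a) := fun R =>
    Finset.prod_subtype_of_mem (fun a => 1 - z / a) fun a ha =>
      ((hfin R).mem_toFinset.1 ha).1
  rw [h1, div_one, ← tendsto_nhds_unique ((hmul.hasProd.comp hexhaust).congr hprod)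
    (tendsto_prod_zeros_norm_le hf h1 hρ1 hB hD hgr hsimple z)]
  exact hmul.hasProd

end Zeros

section Primitives

variable {E E' : Type*} [NormedAddCommGroup E] [NormedSpace ℝ E]
  [NormedAddCommGroup E'] [NormedSpace ℝ E']

/-- `F` is an indefinite Lebesgue integral of `f` on the interval with endpoints `a` and `b`:
`F' = f` in the sense of Carathéodory. -/
structure IsPrimitiveOn (F f : ℝ → E) (a b : ℝ) : Prop where
  intervalIntegrable : IntervalIntegrable f volume a b
  eq_add_integral : ∀ x ∈ uIcc a b, F x = F a + ∫ t in a..x, f t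

lemma absolutelyContinuousOnInterval_of_dist_le {X Y : Type*} [PseudoMetricSpace X]
    [PseudoMetricSpace Y] {f : ℝ → X} {g : ℝ → Y} {a b : ℝ}
    (hg : AbsolutelyContinuousOnInterval g a b)
    (hfg : ∀ x ∈ uIcc a b, ∀ y ∈ uIcc a b, dist (f x) (f y) ≤ dist (g x) (g y)) :
    AbsolutelyContinuousOnInterval f a b := by
  rw [absolutelyContinuousOnInterval_iff] at hg ⊢
  intro ε hε
  obtain ⟨δ, hδ, h⟩ := hg ε hε
  refine ⟨δ, hδ, fun P hP hPδ => lt_of_le_of_lt ?_ (h P hP hPδ)⟩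
  exact Finset.sum_le_sum fun i hi => hfg _ (hP.1 i hi).1 _ (hP.1 i hi).2

namespace IsPrimitiveOn

variable {F G f g : ℝ → E} {a b : ℝ}

lemma intervalIntegrable_of_mem (hF : IsPrimitiveOn F f a b) {x y : ℝ} (hx : x ∈ uIcc a b)
    (hy : y ∈ uIcc a b) : IntervalIntegrable f volume x y :=
  hF.intervalIntegrable.mono_set (uIcc_subset_uIcc hx hy)

lemma sub_eq_integral (hF : IsPrimitiveOn F f a b) {x y : ℝ} (hx : x ∈ uIcc a b)
    (hy : y ∈ uIcc a b) : F y - F x = ∫ t in x..y, f t := by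
  rw [hF.eq_add_integral x hx, hF.eq_add_integral y hy, add_sub_add_left_eq_sub,
    intervalIntegral.integral_interval_sub_left (hF.intervalIntegrable_of_mem left_mem_uIcc hy)
      (hF.intervalIntegrable_of_mem left_mem_uIcc hx)]

lemma congr (hF : IsPrimitiveOn F f a b) (hG : EqOn G F (uIcc a b)) (hg : EqOn g f (uIcc a b)) :
    IsPrimitiveOn G g a b where
  intervalIntegrable := hF.intervalIntegrable.congr (hg.symm.mono uIoc_subset_uIcc)
  eq_add_integral x hx := by
    rw [hG hx, hG left_mem_uIcc, hF.eq_add_integral x hx,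
      intervalIntegral.integral_congr (hg.symm.mono (uIcc_subset_uIcc left_mem_uIcc hx))]

lemma add (hF : IsPrimitiveOn F f a b) (hG : IsPrimitiveOn G g a b) :
    IsPrimitiveOn (fun x => F x + G x) (fun x => f x + g x) a b where
  intervalIntegrable := hF.intervalIntegrable.add hG.intervalIntegrable
  eq_add_integral x hx := by
    rw [intervalIntegral.integral_add (hF.intervalIntegrable_of_mem left_mem_uIcc hx)
      (hG.intervalIntegrable_of_mem left_mem_uIcc hx), hF.eq_add_integral x hx,
      hG.eq_add_integral x hx]
    abel

lemma map [CompleteSpace E] [CompleteSpace E'] (hF : IsPrimitiveOn F f a b) (L : E →L[ℝ] E') :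
    IsPrimitiveOn (fun x => L (F x)) (fun x => L (f x)) a b where
  intervalIntegrable :=
    ⟨L.integrable_comp hF.intervalIntegrable.1, L.integrable_comp hF.intervalIntegrable.2⟩
  eq_add_integral x hx := by
    rw [L.intervalIntegral_comp_comm (hF.intervalIntegrable_of_mem left_mem_uIcc hx),
      hF.eq_add_integral x hx, map_add]

lemma sub [CompleteSpace E] (hF : IsPrimitiveOn F f a b) (hG : IsPrimitiveOn G g a b) :
    IsPrimitiveOn (fun x => F x - G x) (fun x => f x - g x) a b :=
  (hF.add (hG.map (-ContinuousLinearMap.id ℝ E))).congr (fun _ _ => sub_eq_add_neg _ _)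
    fun _ _ => sub_eq_add_neg _ _

lemma absolutelyContinuousOnInterval (hF : IsPrimitiveOn F f a b) :
    AbsolutelyContinuousOnInterval F a b := by
  have hn : IntervalIntegrable (fun t => ‖f t‖) volume a b := hF.intervalIntegrable.norm
  refine absolutelyContinuousOnInterval_of_dist_le
    (hn.absolutelyContinuousOnInterval_intervalIntegral left_mem_uIcc) fun x hx y hy => ?_
  rw [dist_eq_norm, hF.sub_eq_integral hy hx, Real.dist_eq,
    intervalIntegral.integral_interval_sub_left
      (hn.mono_set (uIcc_subset_uIcc left_mem_uIcc hx))
      (hn.mono_set (uIcc_subset_uIcc left_mem_uIcc hy))]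
  exact intervalIntegral.norm_integral_le_abs_integral_norm

lemma continuousOn (hF : IsPrimitiveOn F f a b) : ContinuousOn F (uIcc a b) :=
  hF.absolutelyContinuousOnInterval.continuousOn

lemma ae_hasDerivAt [CompleteSpace E] (hF : IsPrimitiveOn F f a b) :
    ∀ᵐ x, x ∈ uIcc a b → HasDerivAt F (f x) x := by
  have hends : ∀ᵐ x : ℝ, x ∉ ({min a b, max a b} : Set ℝ) :=
    measure_eq_zero_iff_ae_notMem.1 ((toFinite _).measure_zero _)
  filter_upwards [hF.intervalIntegrable.ae_hasDerivAt_integral, hends] with x hderiv hne hx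
  have hnhds : uIcc a b ∈ 𝓝 x := by
    simp only [mem_insert_iff, mem_singleton_iff, not_or] at hne
    exact Icc_mem_nhds (lt_of_le_of_ne hx.1 (Ne.symm hne.1)) (lt_of_le_of_ne hx.2 hne.2)
  exact ((hderiv hx a left_mem_uIcc).const_add (F a)).congr_of_eventuallyEq
    (eventually_of_mem hnhds hF.eq_add_integral)

lemma of_ae_hasDerivAt [CompleteSpace E] (hF : AbsolutelyContinuousOnInterval F a b)
    (hf : IntervalIntegrable f volume a b)
    (hderiv : ∀ᵐ x, x ∈ uIcc a b → HasDerivAt F (f x) x) : IsPrimitiveOn F f a b := by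
  have hI : IsPrimitiveOn (fun x => ∫ t in a..x, f t) f a b := ⟨hf, by simp⟩
  have hzero : ∀ᵐ x, x ∈ uIcc a b → HasDerivAt (F - fun x => ∫ t in a..x, f t) 0 x := by
    filter_upwards [hderiv, hI.ae_hasDerivAt] with x h₁ h₂ hx
    simpa using (h₁ hx).sub (h₂ hx)
  obtain ⟨C, hC⟩ :=
    (hF.sub hI.absolutelyContinuousOnInterval).const_of_ae_hasDerivAt_zero hzero
  refine ⟨hf, fun x hx => ?_⟩
  have := (hC x hx).trans (hC a left_mem_uIcc).symm
  simp only [Pi.sub_apply, intervalIntegral.integral_same, sub_zero] at this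
  rw [← this, sub_add_cancel]

lemma mul {𝕜 : Type*} [RCLike 𝕜] {F G f g : ℝ → 𝕜} (hF : IsPrimitiveOn F f a b)
    (hG : IsPrimitiveOn G g a b) :
    IsPrimitiveOn (fun x => F x * G x) (fun x => f x * G x + F x * g x) a b := by
  refine of_ae_hasDerivAt
    (hF.absolutelyContinuousOnInterval.smul hG.absolutelyContinuousOnInterval)
    ((hF.intervalIntegrable.mul_continuousOn hG.continuousOn).add
      (hG.intervalIntegrable.continuousOn_mul hF.continuousOn)) ?_
  filter_upwards [hF.ae_hasDerivAt, hG.ae_hasDerivAt] with x h₁ h₂ hx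
  exact (h₁ hx).mul (h₂ hx)

lemma pow {F f : ℝ → ℝ} (hF : IsPrimitiveOn F f a b) (n : ℕ) :
    IsPrimitiveOn (fun x => F x ^ (n + 1)) (fun x => (n + 1) * F x ^ n * f x) a b := by
  induction n with
  | zero => simpa using hF
  | succ n ih =>
    refine (ih.mul hF).congr (fun x _ => pow_succ _ _) fun x _ => ?_
    push_cast
    ring

lemma of_hasDerivWithinAt [CompleteSpace E]
    (h : ∀ x ∈ Icc a b, HasDerivWithinAt F (f x) (Icc a b) x) (hab : a ≤ b)
    (hf : ContinuousOn f (Icc a b)) : IsPrimitiveOn F f a b where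
  intervalIntegrable := ContinuousOn.intervalIntegrable_of_Icc hab hf
  eq_add_integral x hx := by
    rw [uIcc_of_le hab] at hx
    have hsub : Icc a x ⊆ Icc a b := Icc_subset_Icc_right hx.2
    rw [intervalIntegral.integral_eq_sub_of_hasDerivAt_of_le hx.1
      (fun t ht => (h t (hsub ht)).continuousWithinAt.mono hsub)
      (fun t ht => (h t (hsub (Ioo_subset_Icc_self ht))).hasDerivAt
        (Icc_mem_nhds ht.1 (ht.2.trans_le hx.2)))
      (ContinuousOn.intervalIntegrable_of_Icc hx.1 (hf.mono hsub)), add_sub_cancel]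

lemma hasDerivWithinAt [CompleteSpace E] (hF : IsPrimitiveOn F f a b) (hab : a ≤ b)
    (hf : ContinuousOn f (Icc a b)) {x : ℝ} (hx : x ∈ Icc a b) :
    HasDerivWithinAt F (f x) (Icc a b) x := by
  have hIcc := uIcc_of_le hab
  have : Fact (x ∈ Icc a b) := ⟨hx⟩
  have hderiv := intervalIntegral.integral_hasDerivWithinAt_right
    (hF.intervalIntegrable_of_mem left_mem_uIcc (hIcc ▸ hx)) (s := Icc a b) (t := Icc a b)
    (hf.stronglyMeasurableAtFilter_nhdsWithin measurableSet_Icc x) (hf x hx)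
  exact (hderiv.const_add (F a)).congr (hIcc ▸ hF.eq_add_integral)
    (hF.eq_add_integral x (hIcc ▸ hx))

lemma monotoneOn {F f : ℝ → ℝ} (hF : IsPrimitiveOn F f a b) (hab : a ≤ b)
    (hf : ∀ x ∈ Icc a b, 0 ≤ f x) : MonotoneOn F (Icc a b) := by
  intro x hx y hy hxy
  have hIcc := uIcc_of_le hab
  rw [← sub_nonneg, hF.sub_eq_integral (hIcc ▸ hx) (hIcc ▸ hy)]
  exact intervalIntegral.integral_nonneg hxy fun t ht =>
    hf t ⟨hx.1.trans ht.1, ht.2.trans hy.2⟩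

end IsPrimitiveOn

end Primitives

section LinearSystem

lemma isUnit_one_sub_of_norm_pow_le {R : Type*} [NormedRing R] [CompleteSpace R] {T : R} {M : ℝ}
    (hT : ∀ n : ℕ, ‖T ^ n‖ ≤ M ^ n / n.factorial) :
    IsUnit (1 - T) ∧ ‖Ring.inverse (1 - T)‖ ≤ Real.exp M := by
  have hsum : Summable (T ^ ·) := .of_norm_bounded (Real.summable_pow_div_factorial M) hT
  have hunit : IsUnit (1 - T) :=
    ⟨⟨_, _, hsum.one_sub_mul_tsum_pow, hsum.tsum_pow_mul_one_sub⟩, rfl⟩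
  have hinv : Ring.inverse (1 - T) = ∑' n : ℕ, T ^ n := by
    simpa only [hsum.one_sub_mul_tsum_pow, mul_one] using
      Ring.inverse_mul_cancel_left (1 - T) (∑' n : ℕ, T ^ n) hunit
  refine ⟨hunit, ?_⟩
  rw [hinv, Real.exp_eq_exp_ℝ, NormedSpace.exp_eq_tsum_div]
  exact tsum_of_norm_bounded (Real.summable_pow_div_factorial M).hasSum hT

lemma differentiableAt_inverse_affine_apply {X : Type*} [NormedAddCommGroup X] [NormedSpace ℂ X]
    [CompleteSpace X] {S T : X →L[ℂ] X} {z : ℂ} (h : IsUnit (1 - (S + z • T))) (x : X) :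
    DifferentiableAt ℂ (fun w : ℂ => (Ring.inverse (1 - (S + w • T)) : X →L[ℂ] X) x) z := by
  have haffine : DifferentiableAt ℂ (fun w : ℂ => 1 - (S + w • T)) z := by fun_prop
  exact ((differentiableAt_inverse (𝕜 := ℂ) h).comp z haffine).clm_apply
    (differentiableAt_const x)

variable {E : Type*} [NormedAddCommGroup E] [NormedSpace ℂ E]
  {A B : ℝ → E →L[ℂ] E} {u v : ℝ → E} {a b : ℝ}

lemma intervalIntegrable_clm_apply (hA : IntervalIntegrable A volume a b)
    (hu : ContinuousOn u (uIcc a b)) : IntervalIntegrable (fun t => A t (u t)) volume a b := by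
  obtain ⟨C, hC⟩ := isCompact_uIcc.exists_bound_of_continuousOn hu
  refine (hA.norm.mul_const C).mono_fun' ?_ ?_
  · exact (ContinuousLinearMap.id ℂ (E →L[ℂ] E)).aestronglyMeasurable_comp₂
      hA.def'.aestronglyMeasurable ((hu.mono uIoc_subset_uIcc).aestronglyMeasurable
        measurableSet_uIoc)
  · filter_upwards [ae_restrict_mem measurableSet_uIoc] with t ht
    exact (A t).le_opNorm_of_le (hC t (uIoc_subset_uIcc ht))

lemma isPrimitiveOn_integral_clm_apply (hab : a ≤ b) (hA : IntervalIntegrable A volume a b)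
    (u : C(Icc a b, E)) :
    IsPrimitiveOn (fun x => ∫ t in a..x, A t (IccExtend hab u t))
      (fun t => A t (IccExtend hab u t)) a b :=
  ⟨intervalIntegrable_clm_apply hA (u.continuous.Icc_extend' (h := hab)).continuousOn, by simp⟩

lemma norm_integral_clm_apply_le (hA : IntervalIntegrable A volume a b) {g : ℝ → ℝ}
    (hg : ContinuousOn g (Icc a b)) (hug : ∀ t ∈ Icc a b, ‖u t‖ ≤ g t) {x : ℝ}
    (hx : x ∈ Icc a b) : ‖∫ t in a..x, A t (u t)‖ ≤ ∫ t in a..x, g t * ‖A t‖ := by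
  have hsub : uIcc a x ⊆ Icc a b := uIcc_subset_Icc (left_mem_Icc.2 (hx.1.trans hx.2)) hx
  refine intervalIntegral.norm_integral_le_of_norm_le hx.1 (.of_forall fun t ht => ?_)
    ((hA.mono_set (hsub.trans Icc_subset_uIcc)).norm.continuousOn_mul (hg.mono hsub))
  rw [mul_comm]
  exact (A t).le_opNorm_of_le (hug t (hsub (uIoc_subset_uIcc (Ioc_subset_uIoc ht))))

/-- The Volterra operator `u ↦ ∫ₐˣ A u`: a solution of `u' = A u`, `u(a) = c` is a solution of the
integral equation `u - ∫ₐˣ A u = c`. -/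
def volterra (hab : a ≤ b) (hA : IntervalIntegrable A volume a b) :
    C(Icc a b, E) →L[ℂ] C(Icc a b, E) :=
  LinearMap.mkContinuous
    { toFun u :=
        ⟨fun x => ∫ t in a..x, A t (IccExtend hab u t),
          ((isPrimitiveOn_integral_clm_apply hab hA u).continuousOn.mono
            Icc_subset_uIcc).domRestrict⟩
      map_add' u v := by
        ext x
        have hx : (x : ℝ) ∈ uIcc a b := Icc_subset_uIcc x.2
        simp only [ContinuousMap.coe_mk, ContinuousMap.add_apply, IccExtend, Function.comp_apply,
          map_add]
        exact intervalIntegral.integral_add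
          ((isPrimitiveOn_integral_clm_apply hab hA u).intervalIntegrable_of_mem left_mem_uIcc hx)
          ((isPrimitiveOn_integral_clm_apply hab hA v).intervalIntegrable_of_mem left_mem_uIcc hx)
      map_smul' c u := by
        ext x
        simp only [ContinuousMap.coe_mk, ContinuousMap.smul_apply, IccExtend, Function.comp_apply,
          map_smul, intervalIntegral.integral_smul, RingHom.id_apply] }
    (∫ t in a..b, ‖A t‖) fun u => by
      have hnonneg : 0 ≤ ∫ t in a..b, ‖A t‖ :=
        intervalIntegral.integral_nonneg hab fun t _ => norm_nonneg _
      refine (ContinuousMap.norm_le _ (by positivity)).2 fun x => ?_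
      calc ‖∫ t in a..x, A t (IccExtend hab u t)‖
          ≤ ∫ t in a..x, ‖u‖ * ‖A t‖ :=
            norm_integral_clm_apply_le hA continuousOn_const (fun t _ => u.norm_coe_le_norm _) x.2
        _ ≤ (∫ t in a..b, ‖A t‖) * ‖u‖ := by
            rw [intervalIntegral.integral_const_mul, mul_comm]
            gcongr
            exact intervalIntegral.integral_mono_interval le_rfl x.2.1 x.2.2
              (.of_forall fun t => norm_nonneg _) hA.norm

lemma volterra_apply (hab : a ≤ b) (hA : IntervalIntegrable A volume a b) (u : C(Icc a b, E))
    (x : Icc a b) : volterra hab hA u x = ∫ t in a..x, A t (IccExtend hab u t) :=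
  rfl

lemma volterra_add_smul (hab : a ≤ b) (hA : IntervalIntegrable A volume a b)
    (hB : IntervalIntegrable B volume a b) (z : ℂ) :
    volterra hab (hA.add (hB.smul z)) = volterra hab hA + z • volterra hab hB := by
  ext u x
  have hx : (x : ℝ) ∈ uIcc a b := Icc_subset_uIcc x.2
  rw [add_apply, smul_apply, ContinuousMap.add_apply,
    ContinuousMap.smul_apply, volterra_apply, volterra_apply, volterra_apply,
    ← intervalIntegral.integral_smul]
  exact intervalIntegral.integral_add
    ((isPrimitiveOn_integral_clm_apply hab hA u).intervalIntegrable_of_mem left_mem_uIcc hx)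
    (((isPrimitiveOn_integral_clm_apply hab hB u).intervalIntegrable_of_mem left_mem_uIcc hx).smul
      z)

lemma norm_volterra_pow_apply_le (hab : a ≤ b) (hA : IntervalIntegrable A volume a b)
    (u : C(Icc a b, E)) (n : ℕ) (x : Icc a b) :
    ‖(volterra hab hA ^ n) u x‖ ≤ ‖u‖ * ((∫ t in a..x, ‖A t‖) ^ n / n.factorial) := by
  have hN : IsPrimitiveOn (fun x => ∫ t in a..x, ‖A t‖) (fun t => ‖A t‖) a b := ⟨hA.norm, by simp⟩
  induction n generalizing x with
  | zero => simpa using u.norm_coe_le_norm x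
  | succ n ih =>
    have hcont : ContinuousOn (fun x => ‖u‖ * ((∫ t in a..x, ‖A t‖) ^ n / n.factorial))
        (Icc a b) :=
      (((hN.continuousOn.mono Icc_subset_uIcc).pow n).div_const _).const_mul _
    rw [pow_succ', ContinuousLinearMap.mul_def, ContinuousLinearMap.comp_apply, volterra_apply]
    refine (norm_integral_clm_apply_le hA hcont (fun t ht => ?_) x.2).trans_eq ?_
    · rw [IccExtend_of_mem hab _ ht]
      exact ih ⟨t, ht⟩
    have hpow := (hN.pow n).sub_eq_integral left_mem_uIcc (Icc_subset_uIcc x.2)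
    simp only [intervalIntegral.integral_same, ne_eq, Nat.succ_ne_zero, not_false_eq_true,
      zero_pow, sub_zero] at hpow
    rw [hpow, ← intervalIntegral.integral_div, ← intervalIntegral.integral_const_mul]
    refine intervalIntegral.integral_congr fun t _ => ?_
    push_cast [Nat.factorial_succ]
    field_simp

lemma norm_volterra_pow_le (hab : a ≤ b) (hA : IntervalIntegrable A volume a b) (n : ℕ) :
    ‖volterra hab hA ^ n‖ ≤ (∫ t in a..b, ‖A t‖) ^ n / n.factorial := by
  have hnonneg : ∀ x ∈ Icc a b, 0 ≤ ∫ t in a..x, ‖A t‖ := fun x hx =>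
    intervalIntegral.integral_nonneg hx.1 fun t _ => norm_nonneg _
  have hM := hnonneg b (right_mem_Icc.2 hab)
  refine ContinuousLinearMap.opNorm_le_bound _ (by positivity) fun u => ?_
  refine (ContinuousMap.norm_le _ (by positivity)).2 fun x => ?_
  refine (norm_volterra_pow_apply_le hab hA u n x).trans ?_
  rw [mul_comm]
  gcongr
  · exact hnonneg x x.2
  · exact intervalIntegral.integral_mono_interval le_rfl x.2.1 x.2.2
      (.of_forall fun t => norm_nonneg _) hA.norm

variable [CompleteSpace E]

lemma isUnit_one_sub_volterra (hab : a ≤ b) (hA : IntervalIntegrable A volume a b) :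
    IsUnit (1 - volterra hab hA) :=
  (isUnit_one_sub_of_norm_pow_le (R := C(Icc a b, E) →L[ℂ] C(Icc a b, E))
    (norm_volterra_pow_le hab hA)).1

/-- The solution of the Cauchy problem `u' = A u`, `u(a) = c` on `[a, b]`. -/
def linearSol (hab : a ≤ b) (hA : IntervalIntegrable A volume a b) (c : E) : C(Icc a b, E) :=
  Ring.inverse (1 - volterra hab hA) (.const _ c)

lemma eq_linearSol_iff (hab : a ≤ b) (hA : IntervalIntegrable A volume a b) {c : E}
    {w : C(Icc a b, E)} :
    w = linearSol hab hA c ↔ ∀ x : Icc a b, w x = c + ∫ t in a..x, A t (IccExtend hab w t) := by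
  have hunit := isUnit_one_sub_volterra hab hA
  calc w = linearSol hab hA c
      ↔ (1 - volterra hab hA) w = .const _ c := by
        constructor
        · rintro rfl
          exact DFunLike.congr_fun (Ring.mul_inverse_cancel _ hunit) _
        · intro h
          rw [linearSol, ← h]
          exact (DFunLike.congr_fun (Ring.inverse_mul_cancel _ hunit) w).symm
    _ ↔ _ := by
        rw [ContinuousMap.ext_iff]
        exact forall_congr' fun x => sub_eq_iff_eq_add

lemma linearSol_apply_left (hab : a ≤ b) (hA : IntervalIntegrable A volume a b) (c : E) :
    IccExtend hab (linearSol hab hA c) a = c := by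
  rw [IccExtend_left, (eq_linearSol_iff hab hA).1 rfl, intervalIntegral.integral_same, add_zero]

lemma isPrimitiveOn_linearSol (hab : a ≤ b) (hA : IntervalIntegrable A volume a b) (c : E) :
    IsPrimitiveOn (IccExtend hab (linearSol hab hA c))
      (fun t => A t (IccExtend hab (linearSol hab hA c) t)) a b where
  intervalIntegrable := (isPrimitiveOn_integral_clm_apply hab hA _).intervalIntegrable
  eq_add_integral x hx := by
    rw [uIcc_of_le hab] at hx
    rw [linearSol_apply_left, IccExtend_of_mem hab _ hx]
    exact (eq_linearSol_iff hab hA).1 rfl ⟨x, hx⟩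

lemma IsPrimitiveOn.eq_linearSol (hu : IsPrimitiveOn u (fun t => A t (u t)) a b) (hab : a ≤ b)
    (hA : IntervalIntegrable A volume a b) {x : ℝ} (hx : x ∈ Icc a b) :
    u x = linearSol hab hA (u a) ⟨x, hx⟩ := by
  let w : C(Icc a b, E) := ⟨_, (hu.continuousOn.mono Icc_subset_uIcc).domRestrict⟩
  have hw : w = linearSol hab hA (u a) := (eq_linearSol_iff hab hA).2 fun y => by
    refine (hu.eq_add_integral y (Icc_subset_uIcc y.2)).trans (congrArg _ ?_)
    refine intervalIntegral.integral_congr fun t ht => ?_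
    have ht' : t ∈ Icc a b := uIcc_subset_Icc (left_mem_Icc.2 hab) y.2 ht
    exact congrArg (A t) (IccExtend_of_mem hab w ht').symm
  exact DFunLike.congr_fun hw ⟨x, hx⟩

lemma norm_linearSol_le (hab : a ≤ b) (hA : IntervalIntegrable A volume a b) (c : E) :
    ‖linearSol hab hA c‖ ≤ Real.exp (∫ t in a..b, ‖A t‖) * ‖c‖ :=
  ContinuousLinearMap.le_of_opNorm_le_of_le _
    (isUnit_one_sub_of_norm_pow_le (R := C(Icc a b, E) →L[ℂ] C(Icc a b, E))
      (norm_volterra_pow_le hab hA)).2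
    ((ContinuousMap.norm_le _ (norm_nonneg c)).2 fun _ => le_rfl)

lemma differentiable_linearSol (hab : a ≤ b) (hA : IntervalIntegrable A volume a b)
    (hB : IntervalIntegrable B volume a b) (c : E) :
    Differentiable ℂ fun z : ℂ => linearSol hab (hA.add (hB.smul z)) c := fun z => by
  have hunit := isUnit_one_sub_volterra hab (hA.add (hB.smul z))
  rw [volterra_add_smul hab hA hB] at hunit
  refine (differentiableAt_inverse_affine_apply hunit (.const _ c)).congr_of_eventuallyEq
    (.of_forall fun w => ?_)
  simp only [linearSol, ← volterra_add_smul hab hA hB]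

end LinearSystem

section ThirdOrderSystem

lemma isPrimitiveOn_pi_iff {ι E : Type*} [Fintype ι] [NormedAddCommGroup E] [NormedSpace ℝ E]
    [CompleteSpace E] {F f : ℝ → ι → E} {a b : ℝ} :
    IsPrimitiveOn F f a b ↔ ∀ i, IsPrimitiveOn (fun x => F x i) (fun x => f x i) a b where
  mp hF i := hF.map (.proj i)
  mpr hF :=
    { intervalIntegrable := ⟨.of_eval fun i => (hF i).intervalIntegrable.1,
        .of_eval fun i => (hF i).intervalIntegrable.2⟩
      eq_add_integral x hx := by
        ext i
        have hint := fun i => (hF i).intervalIntegrable_of_mem left_mem_uIcc hx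
        rw [(hF i).eq_add_integral x hx, Pi.add_apply, intervalIntegral, intervalIntegral,
          Pi.sub_apply, eval_integral fun i => (hint i).1, eval_integral fun i => (hint i).2] }

/-- The operator `v ↦ (κ v₁, κ v₂, w v₀)`: for `κ = 1` it is the coefficient of the first order
system for `(y, y', y'')` equivalent to `y''' = w y`. -/
def companion (κ w : ℂ) : (Fin 3 → ℂ) →L[ℂ] (Fin 3 → ℂ) :=
  .pi ![κ • .proj 1, κ • .proj 2, w • .proj 0]

lemma companion_eq_add (κ w : ℂ) : companion κ w = companion κ 0 + w • companion 0 1 := by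
  ext v j
  fin_cases j <;> simp [companion]

lemma norm_companion_le (κ w : ℂ) : ‖companion κ w‖ ≤ ‖κ‖ + ‖w‖ := by
  refine ContinuousLinearMap.opNorm_le_bound _ (by positivity) fun v => ?_
  refine (pi_norm_le_iff_of_nonneg (by positivity)).2 fun j => ?_
  have hv := norm_le_pi_norm v
  have hκ : ‖κ‖ ≤ ‖κ‖ + ‖w‖ := le_add_of_nonneg_right (norm_nonneg w)
  have hw : ‖w‖ ≤ ‖κ‖ + ‖w‖ := le_add_of_nonneg_left (norm_nonneg κ)
  fin_cases j <;> simp only [companion, ContinuousLinearMap.coe_pi', Matrix.cons_val,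
    smul_apply, ContinuousLinearMap.proj_apply, norm_smul, Fin.zero_eta, Fin.mk_one,
    Fin.reduceFinMk]
  · exact mul_le_mul hκ (hv 1) (norm_nonneg _) (by positivity)
  · exact mul_le_mul hκ (hv 2) (norm_nonneg _) (by positivity)
  · exact mul_le_mul hw (hv 0) (norm_nonneg _) (by positivity)

lemma intervalIntegrable_companion {w : ℝ → ℂ} {a b : ℝ} (hw : IntervalIntegrable w volume a b)
    (κ : ℂ) : IntervalIntegrable (fun t => companion κ (w t)) volume a b := by
  simp only [companion_eq_add κ (w _)]
  have hsmul : IntervalIntegrable (fun t => w t • companion 0 1) volume a b :=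
    ⟨hw.1.smul_const _, hw.2.smul_const _⟩
  exact intervalIntegrable_const.add hsmul

/-- `Y 0`, `Y 1`, `Y 2` are a solution `y` of `i y''' + q y = z y` on `[0, l]` and its first two
derivatives. -/
structure IsSolution (q : ℝ → ℝ) (l : ℝ) (z : ℂ) (Y : Fin 3 → ℝ → ℂ) : Prop where
  deriv_zero : IsPrimitiveOn (Y 0) (Y 1) 0 l
  deriv_one : IsPrimitiveOn (Y 1) (Y 2) 0 l
  deriv_two : IsPrimitiveOn (Y 2) (fun t => -I * (z - q t) * Y 0 t) 0 l

variable {q : ℝ → ℝ} {l : ℝ} {z w : ℂ} {Y W : Fin 3 → ℝ → ℂ}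

lemma intervalIntegrable_coeff (hq : IntervalIntegrable q volume 0 l) (z : ℂ) :
    IntervalIntegrable (fun t => -I * (z - q t)) volume 0 l :=
  have hq' : IntervalIntegrable (fun t => (q t : ℂ)) volume 0 l := ⟨hq.1.ofReal, hq.2.ofReal⟩
  (intervalIntegrable_const.sub hq').const_mul _

/-- Dividing `y^(j)` by `κ ^ j` balances the two parts of the coefficient when `κ³` is of the order
of `z`. -/
lemma isSolution_iff_companion {κ : ℂ} (hκ : κ ≠ 0) :
    IsSolution q l z Y ↔ IsPrimitiveOn (fun x (j : Fin 3) => Y j x / κ ^ (j : ℕ))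
      (fun x => companion κ (-I * (z - q x) / κ ^ 2) fun j => Y j x / κ ^ (j : ℕ)) 0 l := by
  have hdiv : ∀ {F f : ℝ → ℂ} (n : ℕ), IsPrimitiveOn F f 0 l ↔
      IsPrimitiveOn (fun x => F x / κ ^ n) (fun x => f x / κ ^ n) 0 l := fun n =>
    ⟨fun h => by
      simpa [div_eq_inv_mul] using h.map (ContinuousLinearMap.mul ℝ ℂ (κ ^ n)⁻¹),
    fun h => by
      simpa [mul_div_cancel₀, hκ] using h.map (ContinuousLinearMap.mul ℝ ℂ (κ ^ n))⟩
  have hcomp : ∀ x, (companion κ (-I * (z - q x) / κ ^ 2) fun j => Y j x / κ ^ (j : ℕ)) =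
      ![Y 1 x / κ ^ 0, Y 2 x / κ ^ 1, -I * (z - q x) * Y 0 x / κ ^ 2] := fun x => by
    ext j
    fin_cases j <;> simp [companion] <;> field_simp
  calc IsSolution q l z Y
      ↔ IsPrimitiveOn (Y 0) (Y 1) 0 l ∧ IsPrimitiveOn (Y 1) (Y 2) 0 l ∧
          IsPrimitiveOn (Y 2) (fun t => -I * (z - q t) * Y 0 t) 0 l :=
        ⟨fun h => ⟨h.1, h.2, h.3⟩, fun h => ⟨h.1, h.2.1, h.2.2⟩⟩
    _ ↔ _ := by
        rw [isPrimitiveOn_pi_iff, hdiv (F := Y 0) 0, hdiv (F := Y 1) 1, hdiv (F := Y 2) 2]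
        simp only [hcomp, Fin.forall_fin_succ, IsEmpty.forall_iff, and_true]
        exact Iff.rfl

lemma IsSolution.norm_le (hY : IsSolution q l z Y) (hl : 0 ≤ l)
    (hq : IntervalIntegrable q volume 0 l) {κ : ℝ} (hκ : 1 ≤ κ) (hz : ‖z‖ ≤ κ ^ 3) {x : ℝ}
    (hx : x ∈ Icc 0 l) :
    ‖Y 0 x‖ ≤ Real.exp (2 * κ * l + ∫ t in 0..l, |q t|) * ‖fun j => Y j 0‖ := by
  have hκ0 : (κ : ℂ) ≠ 0 := ofReal_ne_zero.2 (by positivity)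
  have hw := (intervalIntegrable_coeff hq z).div_const ((κ : ℂ) ^ 2)
  have hA := intervalIntegrable_companion hw κ
  have hsol := ((isSolution_iff_companion hκ0).1 hY).eq_linearSol hl hA hx
  have hcoeff : ∀ t, ‖companion κ (-I * (z - q t) / κ ^ 2)‖ ≤ 2 * κ + |q t| := fun t => by
    have hκ2 : 1 ≤ κ ^ 2 := one_le_pow₀ hκ
    calc ‖companion κ (-I * (z - q t) / κ ^ 2)‖
        ≤ ‖(κ : ℂ)‖ + ‖-I * (z - q t) / κ ^ 2‖ := norm_companion_le _ _
      _ ≤ κ + (κ ^ 3 + |q t|) / κ ^ 2 := by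
          rw [norm_div, norm_mul, norm_neg, norm_I, one_mul, norm_pow, norm_real,
            Real.norm_of_nonneg (by positivity)]
          gcongr
          exact (norm_sub_le _ _).trans (add_le_add hz (norm_real _).le)
      _ ≤ 2 * κ + |q t| := by
          have h := div_le_self (abs_nonneg (q t)) hκ2
          rw [add_div, pow_succ, mul_div_cancel_left₀ _ (by positivity)]
          linarith
  have hint : ∫ t in 0..l, ‖companion κ (-I * (z - q t) / κ ^ 2)‖ ≤
      2 * κ * l + ∫ t in 0..l, |q t| := by
    calc _ ≤ ∫ t in 0..l, (2 * κ + |q t|) :=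
          intervalIntegral.integral_mono_on hl hA.norm (intervalIntegrable_const.add hq.abs)
            fun t _ => hcoeff t
      _ = 2 * κ * l + ∫ t in 0..l, |q t| := by
          rw [intervalIntegral.integral_add intervalIntegrable_const hq.abs]
          simp only [intervalIntegral.integral_const, sub_zero, smul_eq_mul, mul_comm l]
  have hinit : ‖fun j : Fin 3 => Y j 0 / (κ : ℂ) ^ (j : ℕ)‖ ≤ ‖fun j => Y j 0‖ := by
    refine (pi_norm_le_iff_of_nonneg (norm_nonneg _)).2 fun j => ?_
    rw [norm_div, norm_pow, norm_real, Real.norm_of_nonneg (by positivity)]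
    exact (div_le_self (norm_nonneg _) (one_le_pow₀ hκ)).trans
      (norm_le_pi_norm (fun j => Y j 0) j)
  calc ‖Y 0 x‖ = ‖linearSol hl hA (fun j => Y j 0 / (κ : ℂ) ^ (j : ℕ)) ⟨x, hx⟩ 0‖ := by
        rw [← hsol]
        simp
    _ ≤ ‖linearSol hl hA (fun j => Y j 0 / (κ : ℂ) ^ (j : ℕ))‖ :=
        (norm_le_pi_norm _ 0).trans (ContinuousMap.norm_coe_le_norm _ _)
    _ ≤ _ := (norm_linearSol_le hl hA _).trans (by gcongr)

/-- The solution of `i y''' + q y = z y` on `[0, l]` with initial data `c` at `0`, together with its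
first two derivatives. -/
def solution (hl : 0 ≤ l) (hq : IntervalIntegrable q volume 0 l) (z : ℂ) (c : Fin 3 → ℂ) :
    Fin 3 → ℝ → ℂ := fun j x =>
  IccExtend hl (linearSol hl (intervalIntegrable_companion (intervalIntegrable_coeff hq z) 1) c) x j

variable (hl : 0 ≤ l) (hq : IntervalIntegrable q volume 0 l) (c : Fin 3 → ℂ)

lemma isSolution_solution (z : ℂ) : IsSolution q l z (solution hl hq z c) := by
  rw [isSolution_iff_companion one_ne_zero]
  simp only [one_pow, div_one]
  exact isPrimitiveOn_linearSol hl
    (intervalIntegrable_companion (intervalIntegrable_coeff hq z) 1) c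

lemma solution_apply_zero (z : ℂ) (j : Fin 3) : solution hl hq z c j 0 = c j :=
  congrFun (linearSol_apply_left hl _ c) j


lemma IsSolution.eq_solution (hY : IsSolution q l z Y) (j : Fin 3) {x : ℝ} (hx : x ∈ Icc 0 l) :
    Y j x = solution hl hq z (fun j => Y j 0) j x := by
  rw [isSolution_iff_companion one_ne_zero] at hY
  simp only [one_pow, div_one] at hY
  rw [solution, IccExtend_of_mem hl _ hx]
  exact congrFun (hY.eq_linearSol hl
    (intervalIntegrable_companion (intervalIntegrable_coeff hq z) 1) hx) j

lemma differentiable_linearSol_companion : Differentiable ℂ fun z => linearSol hl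
    (intervalIntegrable_companion (intervalIntegrable_coeff hq z) 1) c := by
  have hA := intervalIntegrable_companion (intervalIntegrable_coeff hq 0) 1
  have hB : IntervalIntegrable (fun _ => companion 0 (-I)) volume 0 l := intervalIntegrable_const
  convert differentiable_linearSol hl hA hB c using 6 with z t
  ext v j
  fin_cases j <;> simp [companion]
  ring

lemma differentiable_solution (j : Fin 3) (x : ℝ) :
    Differentiable ℂ fun z => solution hl hq z c j x := by
  let L : C(Icc 0 l, Fin 3 → ℂ) →L[ℂ] ℂ :=
    .comp (.proj j) (ContinuousMap.evalCLM ℂ (projIcc 0 l hl x))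
  unfold solution
  exact (L.differentiable.comp (differentiable_linearSol_companion hl hq c) :)

lemma continuous_solution (j : Fin 3) :
    Continuous fun p : ℂ × ℝ => solution hl hq p.1 c j p.2 :=
  (continuous_apply j).comp
    (((differentiable_linearSol_companion hl hq c).continuous.comp continuous_fst).eval
      (continuous_projIcc.comp continuous_snd))

lemma hasExpGrowth_solution :
    HasExpGrowth (1 / 3) fun z => solution hl hq z c 0 l := by
  refine ⟨2 * l, isBigO_top.2 ⟨Real.exp (2 * l + ∫ t in 0..l, |q t|) * ‖c‖, fun z => ?_⟩⟩
  have hr : 0 ≤ ‖z‖ ^ (1 / 3 : ℝ) := by positivity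
  have hz : ‖z‖ ≤ (1 + ‖z‖ ^ (1 / 3 : ℝ)) ^ 3 := by
    calc ‖z‖ = (‖z‖ ^ (1 / 3 : ℝ)) ^ 3 := by
          rw [← Real.rpow_mul_natCast (norm_nonneg z)]
          norm_num
      _ ≤ _ := by
          gcongr
          linarith
  rw [Real.norm_eq_abs, Real.abs_exp, mul_right_comm, ← Real.exp_add]
  refine ((isSolution_solution hl hq c z).norm_le hl hq (by linarith) hz
    (right_mem_Icc.2 hl)).trans_eq ?_
  simp only [solution_apply_zero]
  congr 2
  ring

end ThirdOrderSystem

section Identities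

lemma IsPrimitiveOn.const_mul {F f : ℝ → ℂ} {a b : ℝ} (hF : IsPrimitiveOn F f a b) (c : ℂ) :
    IsPrimitiveOn (fun x => c * F x) (fun x => c * f x) a b :=
  hF.map (ContinuousLinearMap.mul ℝ ℂ c)

lemma IsPrimitiveOn.conj {F f : ℝ → ℂ} {a b : ℝ} (hF : IsPrimitiveOn F f a b) :
    IsPrimitiveOn (fun x => conj (F x)) (fun x => conj (f x)) a b :=
  hF.map conjCLE.toContinuousLinearMap

lemma IsPrimitiveOn.re {F f : ℝ → ℂ} {a b : ℝ} (hF : IsPrimitiveOn F f a b) :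
    IsPrimitiveOn (fun x => (F x).re) (fun x => (f x).re) a b :=
  hF.map reCLM

/-- The boundary form of Lagrange's identity for `i D³ + q`. -/
def lagrangeForm (Y W : Fin 3 → ℝ → ℂ) (x : ℝ) : ℂ :=
  Y 2 x * conj (W 0 x) - Y 1 x * conj (W 1 x) + Y 0 x * conj (W 2 x)

/-- The conjugated `2 × 2` minors of two solutions and their derivatives. The first one solves the
equation with the conjugate spectral parameter, and the others are its derivatives. -/
def wedge (Y W : Fin 3 → ℝ → ℂ) : Fin 3 → ℝ → ℂ :=
  ![fun x => conj (Y 1 x * W 0 x - Y 0 x * W 1 x),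
    fun x => conj (Y 2 x * W 0 x - Y 0 x * W 2 x),
    fun x => conj (Y 2 x * W 1 x - Y 1 x * W 2 x)]

namespace IsSolution

variable {q : ℝ → ℝ} {l : ℝ} {z w : ℂ} {Y W : Fin 3 → ℝ → ℂ}

lemma add (hY : IsSolution q l z Y) (hW : IsSolution q l z W) :
    IsSolution q l z (Y + W) where
  deriv_zero := hY.deriv_zero.add hW.deriv_zero
  deriv_one := hY.deriv_one.add hW.deriv_one
  deriv_two := (hY.deriv_two.add hW.deriv_two).congr (fun _ _ => rfl) fun _ _ => mul_add _ _ _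

lemma smul (hY : IsSolution q l z Y) (c : ℂ) : IsSolution q l z (c • Y) where
  deriv_zero := hY.deriv_zero.const_mul c
  deriv_one := hY.deriv_one.const_mul c
  deriv_two := (hY.deriv_two.const_mul c).congr (fun _ _ => rfl) fun _ _ => mul_left_comm _ _ _

lemma isPrimitiveOn_lagrangeForm (hY : IsSolution q l z Y) (hW : IsSolution q l w W) :
    IsPrimitiveOn (lagrangeForm Y W) (fun x => -I * (z - conj w) * (Y 0 x * conj (W 0 x))) 0 l := by
  refine (((hY.deriv_two.mul hW.deriv_zero.conj).sub (hY.deriv_one.mul hW.deriv_one.conj)).add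
    (hY.deriv_zero.mul hW.deriv_two.conj)).congr (fun _ _ => rfl) fun x _ => ?_
  simp only [map_mul, map_neg, map_sub, conj_I, conj_ofReal]
  ring

lemma wedge (hY : IsSolution q l z Y) (hW : IsSolution q l z W) :
    IsSolution q l (conj z) (wedge Y W) where
  deriv_zero := ((hY.deriv_one.mul hW.deriv_zero).sub (hY.deriv_zero.mul hW.deriv_one)).conj.congr
    (fun _ _ => rfl) fun x _ => by
      simp only [ThirdOrder.wedge, Matrix.cons_val]
      congr 1
      ring
  deriv_one := ((hY.deriv_two.mul hW.deriv_zero).sub (hY.deriv_zero.mul hW.deriv_two)).conj.congr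
    (fun _ _ => rfl) fun x _ => by
      simp only [ThirdOrder.wedge, Matrix.cons_val]
      congr 1
      ring
  deriv_two := ((hY.deriv_two.mul hW.deriv_one).sub (hY.deriv_one.mul hW.deriv_two)).conj.congr
    (fun _ _ => rfl) fun x _ => by
      simp only [ThirdOrder.wedge, Matrix.cons_val, map_mul, map_neg, map_sub, map_add, conj_I,
        conj_ofReal]
      ring

lemma hasDerivWithinAt_zero (hY : IsSolution q l z Y) (hl : 0 ≤ l) {x : ℝ} (hx : x ∈ Icc 0 l) :
    HasDerivWithinAt (Y 0) (Y 1 x) (Icc 0 l) x :=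
  hY.deriv_zero.hasDerivWithinAt hl (hY.deriv_one.continuousOn.mono Icc_subset_uIcc) hx

lemma hasDerivWithinAt_one (hY : IsSolution q l z Y) (hl : 0 ≤ l) {x : ℝ} (hx : x ∈ Icc 0 l) :
    HasDerivWithinAt (Y 1) (Y 2 x) (Icc 0 l) x :=
  hY.deriv_one.hasDerivWithinAt hl (hY.deriv_two.continuousOn.mono Icc_subset_uIcc) hx

lemma eqOn_zero (hY : IsSolution q l z Y) (hl : 0 < l) (h : EqOn (Y 0) 0 (Icc 0 l)) :
    EqOn (Y 1) 0 (Icc 0 l) ∧ EqOn (Y 2) 0 (Icc 0 l) := by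
  have hderiv : ∀ {f f' : ℝ → ℂ}, (∀ x ∈ Icc 0 l, HasDerivWithinAt f (f' x) (Icc 0 l) x) →
      EqOn f 0 (Icc 0 l) → EqOn f' 0 (Icc 0 l) := fun hf hf0 x hx =>
    (uniqueDiffOn_Icc hl x hx).eq_deriv _ (hf x hx)
      ((hasDerivWithinAt_const x _ 0).congr hf0 (hf0 hx))
  have h1 := hderiv (fun _ => hY.hasDerivWithinAt_zero hl.le) h
  exact ⟨h1, hderiv (fun _ => hY.hasDerivWithinAt_one hl.le) h1⟩

lemma monotoneOn_re_lagrangeForm (hY : IsSolution q l z Y) (hl : 0 ≤ l) (hz : 0 ≤ z.im) :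
    MonotoneOn (fun x => (lagrangeForm Y Y x).re) (Icc 0 l) := by
  refine (hY.isPrimitiveOn_lagrangeForm hY).re.monotoneOn hl fun x _ => ?_
  have hre : (-I * (z - conj z) * (Y 0 x * conj (Y 0 x))).re = 2 * z.im * normSq (Y 0 x) := by
    rw [mul_conj, re_mul_ofReal, sub_conj]
    simp
  rw [hre]
  have := normSq_nonneg (Y 0 x)
  positivity

lemma isPrimitiveOn_normSq (hY : IsSolution q l z Y) :
    IsPrimitiveOn (fun x => normSq (Y 0 x)) (fun x => 2 * (Y 1 x * conj (Y 0 x)).re) 0 l :=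
  (hY.deriv_zero.mul hY.deriv_zero.conj).re.congr
    (fun x _ => by simp only [mul_conj, ofReal_re]) fun x _ => by
      simp only [add_re, mul_re, conj_re, conj_im]
      ring

lemma isPrimitiveOn_re_mul_conj (hY : IsSolution q l z Y) :
    IsPrimitiveOn (fun x => (Y 1 x * conj (Y 0 x)).re)
      (fun x => ((lagrangeForm Y Y x).re + 3 * normSq (Y 1 x)) / 2) 0 l :=
  (hY.deriv_one.mul hY.deriv_zero.conj).re.congr (fun _ _ => rfl) fun x _ => by
    simp only [lagrangeForm, add_re, sub_re, mul_re, conj_re, conj_im, normSq_apply]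
    ring

lemma monotoneOn_normSq (hY : IsSolution q l z Y) (hl : 0 ≤ l) (hz : 0 ≤ z.im)
    (hform : 0 ≤ (lagrangeForm Y Y 0).re) (hslope : 0 ≤ (Y 1 0 * conj (Y 0 0)).re) :
    MonotoneOn (fun x => normSq (Y 0 x)) (Icc 0 l) := by
  have h0 := left_mem_Icc.2 hl
  have hform' : ∀ x ∈ Icc 0 l, 0 ≤ (lagrangeForm Y Y x).re := fun x hx =>
    hform.trans (hY.monotoneOn_re_lagrangeForm hl hz h0 hx hx.1)
  have hslope' : ∀ x ∈ Icc 0 l, 0 ≤ (Y 1 x * conj (Y 0 x)).re := fun x hx =>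
    hslope.trans (hY.isPrimitiveOn_re_mul_conj.monotoneOn hl (fun t ht => by
      have := hform' t ht
      have := normSq_nonneg (Y 1 t)
      positivity) h0 hx hx.1)
  exact hY.isPrimitiveOn_normSq.monotoneOn hl fun x hx => mul_nonneg zero_le_two (hslope' x hx)

lemma ne_zero_right (hY : IsSolution q l z Y) (hl : 0 < l) (hz : 0 ≤ z.im)
    (hform : 0 ≤ (lagrangeForm Y Y 0).re) (hslope : 0 ≤ (Y 1 0 * conj (Y 0 0)).re)
    (hY2 : Y 2 0 ≠ 0) : Y 0 l ≠ 0 := fun hYl => by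
  have hmono := hY.monotoneOn_normSq hl.le hz hform hslope
  have hzero : EqOn (Y 0) 0 (Icc 0 l) := fun x hx => by
    have hle := hmono hx (right_mem_Icc.2 hl.le) hx.2
    simp only [hYl, map_zero] at hle
    exact normSq_eq_zero.1 (hle.antisymm (normSq_nonneg _))
  exact hY2 ((hY.eqOn_zero hl hzero).2 (left_mem_Icc.2 hl.le))

end IsSolution

variable {q : ℝ → ℝ} {l : ℝ} {lam : ℂ} {c : Fin 3 → ℂ} {Y : Fin 3 → ℝ → ℂ}

lemma integral_equation_iff {f g : ℝ → ℂ} {γ : ℂ} (hl : 0 ≤ l)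
    (hg : IntervalIntegrable g volume 0 l) :
    (∀ x ∈ Icc 0 l, I * (f x - γ) = ∫ t in 0..x, g t) ↔
      IsPrimitiveOn f (fun t => -I * g t) 0 l ∧ f 0 = γ := by
  have hsolve : ∀ u v : ℂ, I * (u - γ) = v ↔ u = γ + -I * v := fun u v =>
    ⟨fun h => by linear_combination -I * h + (u - γ) * I_sq, fun h => by
      linear_combination I * h - v * I_sq⟩
  simp only [hsolve, ← intervalIntegral.integral_const_mul]
  rw [← uIcc_of_le hl]
  refine ⟨fun h => ?_, fun ⟨h, h0⟩ x hx => h0 ▸ h.eq_add_integral x hx⟩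
  have h0 : f 0 = γ := by simpa using h 0 left_mem_uIcc
  exact ⟨⟨hg.const_mul _, h0.symm ▸ h⟩, h0⟩

lemma isCauchySolution_iff (hl : 0 ≤ l) (hq : IntervalIntegrable q volume 0 l) :
    IsCauchySolution q l lam c Y ↔ IsSolution q l (lam ^ 3) Y ∧ ∀ j, Y j 0 = c j := by
  have hint : ∀ {y : ℝ → ℂ}, ContinuousOn y (Icc 0 l) →
      IntervalIntegrable (fun t => (lam ^ 3 - q t) * y t) volume 0 l := fun hy => by
    have hq' : IntervalIntegrable (fun t => (q t : ℂ)) volume 0 l := ⟨hq.1.ofReal, hq.2.ofReal⟩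
    exact (intervalIntegrable_const.sub hq').mul_continuousOn (by rwa [uIcc_of_le hl])
  constructor
  · rintro ⟨h0, h1, heq, hc0, hc1⟩
    have hY0 : ContinuousOn (Y 0) (Icc 0 l) := fun x hx => (h0 x hx).continuousWithinAt
    have hY1 : ContinuousOn (Y 1) (Icc 0 l) := fun x hx => (h1 x hx).continuousWithinAt
    obtain ⟨h2, hc2⟩ := (integral_equation_iff hl (hint hY0)).1 heq
    refine ⟨⟨.of_hasDerivWithinAt h0 hl hY1,
      .of_hasDerivWithinAt h1 hl (h2.continuousOn.mono Icc_subset_uIcc),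
      h2.congr (fun _ _ => rfl) fun _ _ => mul_assoc _ _ _⟩, fun j => ?_⟩
    fin_cases j
    exacts [hc0, hc1, hc2]
  · rintro ⟨hY, hc⟩
    exact ⟨fun x => hY.hasDerivWithinAt_zero hl, fun x => hY.hasDerivWithinAt_one hl,
      (integral_equation_iff hl (hint (hY.deriv_zero.continuousOn.mono Icc_subset_uIcc))).2
        ⟨hY.deriv_two.congr (fun _ _ => rfl) fun _ _ => (mul_assoc _ _ _).symm, hc 2⟩, hc 0, hc 1⟩

lemma fundSol_eq (hl : 0 ≤ l) (hq : IntervalIntegrable q volume 0 l) (p : Fin 3) (lam : ℂ)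
    (j : Fin 3) {x : ℝ} (hx : x ∈ Icc 0 l) :
    fundSol q l p lam j x = solution hl hq (lam ^ 3) (Pi.single p 1) j x := by
  have hex : IsCauchySolution q l lam (Pi.single p 1) (fundSol q l p lam) :=
    Classical.epsilon_spec (p := IsCauchySolution q l lam (Pi.single p 1))
      ⟨_, (isCauchySolution_iff hl hq).2
        ⟨isSolution_solution hl hq _ _, solution_apply_zero hl hq _ _⟩⟩
  obtain ⟨hsol, hinit⟩ := (isCauchySolution_iff hl hq).1 hex
  rw [hsol.eq_solution hl hq j hx, funext hinit]

end Identities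

section HermiteBiehler

/-- `U` is an entire function of Hermite–Biehler type on the closed upper half-plane, with the
reproducing kernel `K` of the de Branges space of `U` (up to normalisation). -/
structure IsHermiteBiehler (U : ℂ → ℂ) (K : ℂ → ℂ → ℂ) : Prop where
  differentiable : Differentiable ℂ U
  ne_zero : ∀ z, 0 ≤ z.im → U z ≠ 0
  continuous_kernel : ∀ w, Continuous fun z => K z w
  kernel_ne_zero : ∀ z, U z ≠ 0 → K z z ≠ 0
  identity : ∀ z w, U z * conj (U w) - conj (U (conj z)) * U (conj w) =
    -I * (z - conj w) * K z w

/-- The combination `U♯ + θ U`, where `U♯ z = conj (U (conj z))`. For `‖θ‖ = 1` it plays the role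
of a characteristic function. -/
def sharpAdd (U : ℂ → ℂ) (θ z : ℂ) : ℂ := conj (U (conj z)) + θ * U z

variable {U : ℂ → ℂ} {K : ℂ → ℂ → ℂ} {θ z : ℂ} {ρ : ℝ}

lemma differentiable_sharpAdd (hU : Differentiable ℂ U) (θ : ℂ) :
    Differentiable ℂ (sharpAdd U θ) := fun z => by
  have hsharp : DifferentiableAt ℂ (conj ∘ U ∘ conj) (conj (conj z)) := (hU (conj z)).conj_conj
  rw [conj_conj] at hsharp
  exact hsharp.add ((hU z).const_mul θ)

lemma HasExpGrowth.sharpAdd (hU : HasExpGrowth ρ U) (θ : ℂ) : HasExpGrowth ρ (sharpAdd U θ) :=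
  hU.conj_conj.add (hU.const_mul θ)

lemma mul_conj_eq_one (hθ : ‖θ‖ = 1) : θ * conj θ = 1 := by
  rw [mul_conj', hθ, ofReal_one, one_pow]

lemma exists_pow_eq_of_odd {n : ℕ} (hn : Odd n) (x : ℝ) : ∃ y : ℝ, y ^ n = x := by
  rcases le_total 0 x with hx | hx
  · exact ⟨_, Real.rpow_inv_natCast_pow hx hn.pos.ne'⟩
  · exact ⟨-(-x) ^ (n : ℝ)⁻¹, by
      rw [hn.neg_pow, Real.rpow_inv_natCast_pow (neg_nonneg.2 hx) hn.pos.ne', neg_neg]⟩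

namespace IsHermiteBiehler

lemma ne_zero_of_sharpAdd_eq_zero (hU : IsHermiteBiehler U K) (hz : sharpAdd U θ z = 0) :
    U z ≠ 0 := fun h0 => by
  rw [sharpAdd, h0, mul_zero, add_zero, map_eq_zero] at hz
  rcases le_total 0 z.im with h | h
  · exact hU.ne_zero z h h0
  · exact hU.ne_zero (conj z) (by simpa using h) hz

lemma im_eq_zero (hU : IsHermiteBiehler U K) (hθ : ‖θ‖ = 1) (hz : sharpAdd U θ z = 0) :
    z.im = 0 := by
  have hsharp : conj (U (conj z)) = -(θ * U z) := eq_neg_of_add_eq_zero_left hz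
  have hconj : U (conj z) = -(conj θ * conj (U z)) := by simpa using congrArg conj hsharp
  have hprod : -I * (z - conj z) * K z z = 0 := by
    rw [← hU.identity z z, hsharp, hconj]
    linear_combination -(U z * conj (U z)) * mul_conj_eq_one hθ
  have hsub := (mul_eq_zero.1 hprod).resolve_right
    (hU.kernel_ne_zero z (hU.ne_zero_of_sharpAdd_eq_zero hz))
  rw [sub_conj] at hsub
  simpa using hsub

lemma mul_sharpAdd_eq (hU : IsHermiteBiehler U K) (hθ : ‖θ‖ = 1) (hz : sharpAdd U θ z = 0)
    (w : ℂ) : conj (U z) * conj θ * sharpAdd U θ w = -I * (w - z) * K w z := by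
  have hreal : conj z = z := conj_eq_iff_im.2 (hU.im_eq_zero hθ hz)
  have hsharp : conj (U z) = -(θ * U z) :=
    eq_neg_of_add_eq_zero_left (by simpa only [sharpAdd, hreal] using hz)
  have hconj : U z = -(conj θ * conj (U z)) := by simpa using congrArg conj hsharp
  have hid := hU.identity w z
  rw [hreal] at hid
  rw [← hid, sharpAdd]
  linear_combination U w * conj (U z) * mul_conj_eq_one hθ + conj (U (conj w)) * hconj

lemma deriv_ne_zero (hU : IsHermiteBiehler U K) (hθ : ‖θ‖ = 1) (hz : sharpAdd U θ z = 0) :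
    deriv (sharpAdd U θ) z ≠ 0 := fun hderiv => by
  have hslope : Tendsto (fun w => -I * K w z) (𝓝[≠] z) (𝓝 0) := by
    have hlim := (differentiable_sharpAdd hU.differentiable θ z).hasDerivAt
    rw [hderiv, hasDerivAt_iff_tendsto_slope] at hlim
    refine (mul_zero (conj (U z) * conj θ) ▸ hlim.const_mul _).congr' ?_
    filter_upwards [self_mem_nhdsWithin] with w hw
    have hw' : w - z ≠ 0 := sub_ne_zero.2 hw
    rw [slope_def_field, hz, sub_zero, ← mul_div_assoc, hU.mul_sharpAdd_eq hθ hz]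
    field_simp
  have hkernel : Tendsto (fun w => -I * K w z) (𝓝[≠] z) (𝓝 (-I * K z z)) :=
    (((hU.continuous_kernel z).tendsto z).const_mul _).mono_left nhdsWithin_le_nhds
  exact mul_ne_zero (neg_ne_zero.2 I_ne_zero)
    (hU.kernel_ne_zero z (hU.ne_zero_of_sharpAdd_eq_zero hz))
    (tendsto_nhds_unique hkernel hslope)

/-- All zeros of `U♯ + θ U` are real, so they are the cubes of the real zeros of
`λ ↦ (U♯ + θ U) (λ ^ 3)`. -/
lemma hasProd_factor (hU : IsHermiteBiehler U K) (hgr : HasExpGrowth ρ U) (hρ : 0 < ρ)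
    (hρ1 : ρ < 1) (hθ : ‖θ‖ = 1) (h0 : sharpAdd U θ 0 ≠ 0) (lam : ℂ) :
    HasProd (fun μ : {μ : ℝ | sharpAdd U θ ((μ : ℂ) ^ 3) = 0} => factor lam μ)
      (sharpAdd U θ (lam ^ 3) / sharpAdd U θ 0) := by
  let cube (μ : {μ : ℝ | sharpAdd U θ ((μ : ℂ) ^ 3) = 0}) : {a : ℂ // sharpAdd U θ a = 0} :=
    ⟨(μ : ℂ) ^ 3, μ.2⟩
  have hodd : Odd 3 := by decide
  have hbij : Function.Bijective cube := by
    refine ⟨fun μ ν hμν => ?_, fun ⟨a, ha⟩ => ?_⟩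
    · have hpow : ((μ : ℝ) : ℂ) ^ 3 = ((ν : ℝ) : ℂ) ^ 3 := congrArg Subtype.val hμν
      exact Subtype.ext (hodd.pow_injective (mod_cast hpow))
    · obtain ⟨μ, hμ⟩ := exists_pow_eq_of_odd hodd a.re
      have hμa : (μ : ℂ) ^ 3 = a := by
        rw [← ofReal_pow, hμ]
        exact Complex.ext (ofReal_re _) (by rw [ofReal_im, hU.im_eq_zero hθ ha])
      exact ⟨⟨μ, by rwa [mem_ofPred_eq, hμa]⟩, Subtype.ext hμa⟩
  exact (Equiv.ofBijective cube hbij).hasProd_iff.2 <|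
    hasProd_one_sub_div_zeros (differentiable_sharpAdd hU.differentiable θ) h0 hρ hρ1
      (hgr.sharpAdd θ) (fun _ => hU.deriv_ne_zero hθ) (lam ^ 3)

end IsHermiteBiehler

end HermiteBiehler

section BoundaryFunction

variable {q : ℝ → ℝ} {l : ℝ} (hl : 0 ≤ l) (hq : IntervalIntegrable q volume 0 l) (h : ℝ)

/-- The initial data `y(0) = i h`, `y'(0) = 0`, `y''(0) = 1`, satisfying `y(0) = i h y''(0)`. -/
def leftData (h : ℝ) : Fin 3 → ℂ := ![I * h, 0, 1]

/-- The value at `l` of the solution with initial data `leftData h`, as a function of the spectral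
parameter `z = λ ^ 3`. -/
def rightValue (z : ℂ) : ℂ := solution hl hq z (leftData h) 0 l

/-- The combination of the solutions satisfying `y(0) = i h y''(0)` which vanishes at `l`,
normalised by `y'(0) = rightValue z`. -/
def vanishingSol (z : ℂ) : Fin 3 → ℝ → ℂ :=
  rightValue hl hq h z • solution hl hq z (Pi.single 1 1) +
    -solution hl hq z (Pi.single 1 1) 0 l • solution hl hq z (leftData h)

/-- The Gram kernel of the solutions `vanishingSol` in `L²(0, l)`. -/
def gramKernel (z w : ℂ) : ℂ :=
  ∫ x in 0..l, vanishingSol hl hq h z 0 x * conj (vanishingSol hl hq h w 0 x)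

lemma conj_rightValue_conj (z : ℂ) :
    conj (rightValue hl hq h (conj z)) =
      solution hl hq z (leftData h) 1 l * solution hl hq z (Pi.single 1 1) 0 l -
        rightValue hl hq h z * solution hl hq z (Pi.single 1 1) 1 l := by
  have hwedge := ((isSolution_solution hl hq (leftData h) z).wedge
    (isSolution_solution hl hq (Pi.single 1 1) z)).eq_solution hl hq 0 (right_mem_Icc.2 hl)
  have hdata : (fun j => wedge (solution hl hq z (leftData h))
      (solution hl hq z (Pi.single 1 1)) j 0) = leftData h := by
    funext j
    fin_cases j <;> simp [wedge, solution_apply_zero, leftData]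
  rw [hdata] at hwedge
  rw [rightValue, ← hwedge]
  exact conj_conj _

lemma isSolution_vanishingSol (z : ℂ) : IsSolution q l z (vanishingSol hl hq h z) :=
  ((isSolution_solution hl hq _ z).smul _).add ((isSolution_solution hl hq _ z).smul _)

lemma vanishingSol_apply (z : ℂ) (j : Fin 3) (x : ℝ) :
    vanishingSol hl hq h z j x = rightValue hl hq h z * solution hl hq z (Pi.single 1 1) j x -
      solution hl hq z (Pi.single 1 1) 0 l * solution hl hq z (leftData h) j x := by
  simp only [vanishingSol, Pi.add_apply, Pi.smul_apply, smul_eq_mul]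
  ring

lemma vanishingSol_zero_right (z : ℂ) : vanishingSol hl hq h z 0 l = 0 := by
  rw [vanishingSol_apply, rightValue, mul_comm, sub_self]

lemma vanishingSol_one_right (z : ℂ) :
    vanishingSol hl hq h z 1 l = -conj (rightValue hl hq h (conj z)) := by
  rw [vanishingSol_apply, conj_rightValue_conj]
  ring

lemma lagrangeForm_vanishingSol_left (z w : ℂ) :
    lagrangeForm (vanishingSol hl hq h z) (vanishingSol hl hq h w) 0 =
      -(rightValue hl hq h z * conj (rightValue hl hq h w)) := by
  simp only [lagrangeForm, vanishingSol_apply, solution_apply_zero, leftData, Matrix.cons_val,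
    Pi.single_apply, Fin.reduceEq, if_true, if_false, map_sub, map_mul, conj_I, conj_ofReal,
    map_one, map_zero]
  ring

lemma lagrangeForm_vanishingSol_right (z w : ℂ) :
    lagrangeForm (vanishingSol hl hq h z) (vanishingSol hl hq h w) l =
      -(conj (rightValue hl hq h (conj z)) * rightValue hl hq h (conj w)) := by
  simp only [lagrangeForm, vanishingSol_zero_right, vanishingSol_one_right, map_neg, map_zero,
    conj_conj]
  ring

lemma rightValue_mul_conj_sub (z w : ℂ) :
    rightValue hl hq h z * conj (rightValue hl hq h w) -
        conj (rightValue hl hq h (conj z)) * rightValue hl hq h (conj w) =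
      -I * (z - conj w) * gramKernel hl hq h z w := by
  have hform := ((isSolution_vanishingSol hl hq h z).isPrimitiveOn_lagrangeForm
    (isSolution_vanishingSol hl hq h w)).sub_eq_integral left_mem_uIcc right_mem_uIcc
  rw [intervalIntegral.integral_const_mul, lagrangeForm_vanishingSol_left,
    lagrangeForm_vanishingSol_right] at hform
  exact (neg_sub_neg _ _).symm.trans hform

lemma differentiable_rightValue : Differentiable ℂ (rightValue hl hq h) :=
  differentiable_solution hl hq _ 0 l

lemma continuous_vanishingSol (j : Fin 3) :
    Continuous fun p : ℂ × ℝ => vanishingSol hl hq h p.1 j p.2 := by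
  have hsol := continuous_solution hl hq
  have hvalue := (differentiable_rightValue hl hq h).continuous
  have hend := (differentiable_solution hl hq (Pi.single 1 1) 0 l).continuous
  simp only [vanishingSol_apply]
  exact ((hvalue.comp continuous_fst).mul (hsol _ j)).sub
    ((hend.comp continuous_fst).mul (hsol _ j))

lemma continuous_gramKernel (w : ℂ) : Continuous fun z => gramKernel hl hq h z w := by
  have hsol := continuous_vanishingSol hl hq h 0
  have hsol' : Continuous fun p : ℂ × ℝ => vanishingSol hl hq h w 0 p.2 :=
    (hsol.comp (Continuous.prodMk_right w)).comp continuous_snd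
  exact intervalIntegral.continuous_parametric_intervalIntegral_of_continuous'
    (hsol.mul hsol'.star) _ _

end BoundaryFunction

section CharFun

variable {q : ℝ → ℝ} {l : ℝ}

lemma gramKernel_self_ne_zero (hl : 0 < l) (hq : IntervalIntegrable q volume 0 l) (h : ℝ) {z : ℂ}
    (hz : rightValue hl.le hq h z ≠ 0) : gramKernel hl.le hq h z z ≠ 0 := by
  set Y := vanishingSol hl.le hq h z with hY
  have hY0 : Continuous fun x => ‖Y 0 x‖ ^ 2 :=
    (((continuous_vanishingSol hl.le hq h 0).comp (Continuous.prodMk_right z)).norm).pow 2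
  have hne : ∃ x ∈ Icc 0 l, Y 0 x ≠ 0 := by
    by_contra! hzero
    refine hz ?_
    have hY1 := ((isSolution_vanishingSol hl.le hq h z).eqOn_zero hl hzero).1
      (left_mem_Icc.2 hl.le)
    simpa [vanishingSol_apply, solution_apply_zero, leftData] using hY1
  obtain ⟨x, hx, hYx⟩ := hne
  have hpos : 0 < ∫ x in 0..l, ‖Y 0 x‖ ^ 2 :=
    intervalIntegral.integral_pos hl hY0.continuousOn (fun t _ => by positivity)
      ⟨x, hx, by positivity⟩
  have hcast : gramKernel hl.le hq h z z = (∫ x in 0..l, ‖Y 0 x‖ ^ 2 : ℝ) := by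
    simp only [gramKernel, mul_conj', ← hY, ← ofReal_pow]
    exact intervalIntegral.integral_ofReal
  rw [hcast]
  exact ofReal_ne_zero.2 hpos.ne'

lemma rightValue_ne_zero (hl : 0 < l) (hq : IntervalIntegrable q volume 0 l) (h : ℝ) {z : ℂ}
    (hz : 0 ≤ z.im) : rightValue hl.le hq h z ≠ 0 :=
  (isSolution_solution hl.le hq (leftData h) z).ne_zero_right hl hz
    (by simp [lagrangeForm, solution_apply_zero, leftData])
    (by simp [solution_apply_zero, leftData]) (by simp [solution_apply_zero, leftData])

theorem isHermiteBiehler_rightValue (hl : 0 < l) (hq : IntervalIntegrable q volume 0 l) (h : ℝ) :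
    IsHermiteBiehler (rightValue hl.le hq h) (gramKernel hl.le hq h) where
  differentiable := differentiable_rightValue hl.le hq h
  ne_zero _ := rightValue_ne_zero hl hq h
  continuous_kernel := continuous_gramKernel hl.le hq h
  kernel_ne_zero _ := gramKernel_self_ne_zero hl hq h
  identity := rightValue_mul_conj_sub hl.le hq h

lemma solution_leftData (hl : 0 ≤ l) (hq : IntervalIntegrable q volume 0 l) (h : ℝ) (lam : ℂ)
    (j : Fin 3) :
    solution hl hq (lam ^ 3) (leftData h) j l =
      fundSol q l 2 lam j l + I * h * fundSol q l 0 lam j l := by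
  have hsum := ((isSolution_solution hl hq (Pi.single 2 1) (lam ^ 3)).add
    ((isSolution_solution hl hq (Pi.single 0 1) (lam ^ 3)).smul (I * h))).eq_solution hl hq j
    (right_mem_Icc.2 hl)
  have hdata : (fun j => (solution hl hq (lam ^ 3) (Pi.single 2 1) +
      (I * h : ℂ) • solution hl hq (lam ^ 3) (Pi.single 0 1)) j 0) = leftData h := by
    funext j
    fin_cases j <;> simp [solution_apply_zero, leftData]
  rw [fundSol_eq hl hq 2 lam j (right_mem_Icc.2 hl), fundSol_eq hl hq 0 lam j (right_mem_Icc.2 hl),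
    ← hdata, ← hsum]
  rfl

lemma rightValue_pow_three (hl : 0 ≤ l) (hq : IntervalIntegrable q volume 0 l) (h : ℝ) (lam : ℂ) :
    rightValue hl hq h (lam ^ 3) = s q l 2 lam + I * h * s q l 0 lam :=
  solution_leftData hl hq h lam 0

lemma charFunH_eq_neg_sharpAdd (hl : 0 ≤ l) (hq : IntervalIntegrable q volume 0 l) (θ : ℂ) (h : ℝ)
    (lam : ℂ) : charFunH q l θ h lam = -sharpAdd (rightValue hl hq h) θ (lam ^ 3) := by
  have hfund := fun j => fundSol_eq hl hq 1 lam j (right_mem_Icc.2 hl)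
  rw [sharpAdd, conj_rightValue_conj, solution_leftData, ← hfund, ← hfund, rightValue_pow_three]
  simp only [charFunH, s, s', Matrix.det_fin_three, Matrix.of_apply, Matrix.cons_val]
  ring

lemma charFunH_eq (q : ℝ → ℝ) (l : ℝ) (θ : ℂ) (h : ℝ) (lam : ℂ) :
    charFunH q l θ h lam = charFun q l θ lam +
      I * h * (s q l 0 lam * s' q l 1 lam - s q l 1 lam * s' q l 0 lam - θ * s q l 0 lam) := by
  simp only [charFunH, charFun, Matrix.det_fin_three, Matrix.of_apply, Matrix.cons_val]
  ring

lemma charFunH_zero_right (q : ℝ → ℝ) (l : ℝ) (θ lam : ℂ) :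
    charFunH q l θ 0 lam = charFun q l θ lam := by
  simp [charFunH_eq]

lemma mul_phase (z : ℂ) : z * phase z = conj z :=
  mul_div_cancel_of_imp' fun hz => by rw [hz, map_zero]

lemma charFunH_apply_zero (hl : 0 ≤ l) (hq : IntervalIntegrable q volume 0 l) (θ : ℂ) (h : ℝ) :
    charFunH q l θ h 0 = -(s q l 2 0 * (θ + phase (s q l 2 0)) +
      I * h * s q l 0 0 * (θ - phase (s q l 0 0))) := by
  have hvalue := rightValue_pow_three hl hq h 0
  rw [charFunH_eq_neg_sharpAdd hl hq, sharpAdd]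
  rw [zero_pow three_ne_zero] at hvalue ⊢
  rw [map_zero, hvalue]
  simp only [map_add, map_mul, conj_I, conj_ofReal]
  linear_combination mul_phase (s q l 2 0) - I * h * mul_phase (s q l 0 0)

theorem hasProd_charFunH (hl : 0 < l) (hq : IntervalIntegrable q volume 0 l) {θ : ℂ}
    (hθ : ‖θ‖ = 1) (h : ℝ) (h0 : charFunH q l θ h 0 ≠ 0) (lam : ℂ) :
    HasProd (fun μ : {μ : ℝ | charFunH q l θ h μ = 0} => factor lam μ)
      (charFunH q l θ h lam / charFunH q l θ h 0) := by
  have hchar := charFunH_eq_neg_sharpAdd hl.le hq θ h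
  have hzeros : {μ : ℝ | charFunH q l θ h μ = 0} =
      {μ : ℝ | sharpAdd (rightValue hl.le hq h) θ ((μ : ℂ) ^ 3) = 0} := by
    simp only [hchar, neg_eq_zero]
  rw [hchar, zero_pow three_ne_zero, neg_ne_zero] at h0
  rw [hzeros, hchar, hchar, zero_pow three_ne_zero, neg_div_neg_eq]
  exact (isHermiteBiehler_rightValue hl hq h).hasProd_factor
    (hasExpGrowth_solution hl.le hq (leftData h)) (by norm_num) (by norm_num) hθ h0 lam

end CharFun

section Reconstruction

variable {q : ℝ → ℝ} {l : ℝ} {θ θ' : ℂ} {h : ℝ}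

lemma multipliable_factor_spectralSetH (hl : 0 < l) (hq : IntervalIntegrable q volume 0 l)
    (hθ : ‖θ‖ = 1) (hA : (spectralSetH q l θ h).Admissible) (lam : ℂ) :
    Multipliable fun μ : (spectralSetH q l θ h).zeros => factor lam μ :=
  (hasProd_charFunH hl hq hθ h (charFunH_apply_zero hl.le hq θ h ▸ neg_ne_zero.2 hA.2.2)
    lam).multipliable

lemma delta_spectralSetH (hl : 0 < l) (hq : IntervalIntegrable q volume 0 l)
    (hθ : ‖θ‖ = 1) (hA : (spectralSetH q l θ h).Admissible) (lam : ℂ) :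
    (spectralSetH q l θ h).delta lam = charFunH q l θ h lam := by
  have hvalue := charFunH_apply_zero hl.le hq θ h
  have h0 : charFunH q l θ h 0 ≠ 0 := hvalue ▸ neg_ne_zero.2 hA.2.2
  refine (congrArg₂ (· * ·) hvalue.symm (hasProd_charFunH hl hq hθ h h0 lam).tprod_eq).trans ?_
  exact mul_div_cancel₀ _ h0

lemma zeros_spectralSet (q : ℝ → ℝ) (l : ℝ) (θ : ℂ) :
    (spectralSet q l θ).zeros = (spectralSetH q l θ 0).zeros := by
  simp only [spectralSet, spectralSetH, charFunH_zero_right]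

lemma SpectralSetH.Admissible.zero_right (hA : (spectralSetH q l θ h).Admissible) :
    (spectralSetH q l θ 0).Admissible :=
  ⟨hA.1, hA.2.1, by simpa [spectralSetH] using And.intro hA.1 hA.2.1⟩

lemma multipliable_factor_spectralSet (hl : 0 < l) (hq : IntervalIntegrable q volume 0 l)
    (hθ : ‖θ‖ = 1) (hA : (spectralSetH q l θ 0).Admissible) (lam : ℂ) :
    Multipliable fun μ : (spectralSet q l θ).zeros => factor lam μ := by
  rw [zeros_spectralSet]
  exact multipliable_factor_spectralSetH hl hq hθ hA lam

lemma delta_spectralSet (hl : 0 < l) (hq : IntervalIntegrable q volume 0 l)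
    (hθ : ‖θ‖ = 1) (hA : (spectralSetH q l θ 0).Admissible) (lam : ℂ) :
    (spectralSet q l θ).delta lam = charFun q l θ lam := by
  rw [← charFunH_zero_right, ← delta_spectralSetH hl hq hθ hA, SpectralSet.delta,
    SpectralSetH.delta, zeros_spectralSet]
  simp [spectralSet, spectralSetH]

lemma SpectralSet.prodFun_mul (A : SpectralSet) (lam : ℂ) :
    A.prodFun lam * (A.θ + phase A.a) = -A.delta lam := by
  rw [prodFun, delta]
  ring

lemma s_two_eq_recoverS2 (hl : 0 < l) (hq : IntervalIntegrable q volume 0 l) (hθ : ‖θ‖ = 1)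
    (hθ' : ‖θ'‖ = 1) (hne : θ ≠ θ') (hA : (spectralSetH q l θ 0).Admissible)
    (hA' : (spectralSetH q l θ' 0).Admissible) (lam : ℂ) :
    s q l 2 lam = recoverS2 (spectralSet q l θ) (spectralSet q l θ') lam := by
  have hsub : θ - θ' ≠ 0 := sub_ne_zero.2 hne
  rw [recoverS2, SpectralSet.prodFun_mul, SpectralSet.prodFun_mul, delta_spectralSet hl hq hθ hA,
    delta_spectralSet hl hq hθ' hA']
  simp only [spectralSet, charFun]
  field_simp
  ring

lemma s_zero_eq_recoverS0 (hl : 0 < l) (hq : IntervalIntegrable q volume 0 l) (hθ : ‖θ‖ = 1)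
    (hθ' : ‖θ'‖ = 1) (hne : θ ≠ θ') (hh : h ≠ 0) (hA : (spectralSetH q l θ h).Admissible)
    (hA' : (spectralSetH q l θ' h).Admissible) (lam : ℂ) :
    s q l 0 lam = recoverS0 (spectralSet q l θ) (spectralSet q l θ')
      (spectralSetH q l θ h) (spectralSetH q l θ' h) lam := by
  have hsub : θ - θ' ≠ 0 := sub_ne_zero.2 hne
  have hIh : I * h ≠ 0 := mul_ne_zero I_ne_zero (ofReal_ne_zero.2 hh)
  rw [recoverS0, delta_spectralSet hl hq hθ hA.zero_right,
    delta_spectralSet hl hq hθ' hA'.zero_right, delta_spectralSetH hl hq hθ hA,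
    delta_spectralSetH hl hq hθ' hA', charFunH_eq, charFunH_eq]
  simp only [spectralSet, spectralSetH]
  rw [one_div, eq_inv_mul_iff_mul_eq₀ (mul_ne_zero hIh hsub)]
  ring

end Reconstruction

end ThirdOrder

end

open ThirdOrder in
theorem lemma4p1_general (l : ℝ) (hl : 0 < l) (θ θ' : ℂ) (hθ : ‖θ‖ = 1) (hθ' : ‖θ'‖ = 1)
    (hne : θ ≠ θ') (h : ℝ) (hh : h ≠ 0) :
    (∀ q : ℝ → ℝ, IntervalIntegrable q volume 0 l →
      (spectralSetH q l θ h).Admissible → (spectralSetH q l θ' h).Admissible →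
      ∀ lam : ℂ,
        (Multipliable (fun μ : (spectralSet q l θ).zeros => factor lam μ) ∧
          Multipliable (fun μ : (spectralSet q l θ').zeros => factor lam μ) ∧
          Multipliable (fun μ : (spectralSetH q l θ h).zeros => factor lam μ) ∧
          Multipliable (fun μ : (spectralSetH q l θ' h).zeros => factor lam μ)) ∧
        ((spectralSet q l θ).delta lam = charFun q l θ lam ∧
          (spectralSet q l θ').delta lam = charFun q l θ' lam ∧
          (spectralSetH q l θ h).delta lam = charFunH q l θ h lam ∧
          (spectralSetH q l θ' h).delta lam = charFunH q l θ' h lam) ∧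
        s q l 2 lam = recoverS2 (spectralSet q l θ) (spectralSet q l θ') lam ∧
        s q l 0 lam = recoverS0 (spectralSet q l θ) (spectralSet q l θ')
          (spectralSetH q l θ h) (spectralSetH q l θ' h) lam) ∧
    (∀ q r : ℝ → ℝ, IntervalIntegrable q volume 0 l →
      IntervalIntegrable r volume 0 l →
      (spectralSetH q l θ h).Admissible → (spectralSetH q l θ' h).Admissible →
      spectralSet q l θ = spectralSet r l θ → spectralSet q l θ' = spectralSet r l θ' →
      spectralSetH q l θ h = spectralSetH r l θ h →
      spectralSetH q l θ' h = spectralSetH r l θ' h →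
      ∀ lam : ℂ, s q l 2 lam = s r l 2 lam ∧ s q l 0 lam = s r l 0 lam) := by
  refine ⟨fun q hq hA hA' lam => ?_, fun q r hq hr hA hA' e1 e2 e3 e4 lam => ?_⟩
  · have hA₀ := hA.zero_right
    have hA₀' := hA'.zero_right
    exact ⟨⟨multipliable_factor_spectralSet hl hq hθ hA₀ lam,
        multipliable_factor_spectralSet hl hq hθ' hA₀' lam,
        multipliable_factor_spectralSetH hl hq hθ hA lam,
        multipliable_factor_spectralSetH hl hq hθ' hA' lam⟩,
      ⟨delta_spectralSet hl hq hθ hA₀ lam, delta_spectralSet hl hq hθ' hA₀' lam,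
        delta_spectralSetH hl hq hθ hA lam, delta_spectralSetH hl hq hθ' hA' lam⟩,
      s_two_eq_recoverS2 hl hq hθ hθ' hne hA₀ hA₀' lam,
      s_zero_eq_recoverS0 hl hq hθ hθ' hne hh hA hA' lam⟩
  · have hB : (spectralSetH r l θ h).Admissible := e3 ▸ hA
    have hB' : (spectralSetH r l θ' h).Admissible := e4 ▸ hA'
    rw [s_two_eq_recoverS2 hl hq hθ hθ' hne hA.zero_right hA'.zero_right,
      s_two_eq_recoverS2 hl hr hθ hθ' hne hB.zero_right hB'.zero_right,
      s_zero_eq_recoverS0 hl hq hθ hθ' hne hh hA hA',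
      s_zero_eq_recoverS0 hl hr hθ hθ' hne hh hB hB', e1, e2, e3, e4]
    exact ⟨rfl, rfl⟩

open ThirdOrder in
theorem lemma4p1 (l : ℝ) (hl : 0 < l) (θ θ' : ℂ) (hθ : ‖θ‖ = 1) (hθ' : ‖θ'‖ = 1)
    (hne : θ ≠ θ') (h : ℝ) (hh : h ≠ 0) :
    (∀ q : ℝ → ℝ, MemLp q 2 (volume.restrict (Ioo 0 l)) →
      (spectralSetH q l θ h).Admissible → (spectralSetH q l θ' h).Admissible →
      ∀ lam : ℂ,
        (Multipliable (fun μ : (spectralSet q l θ).zeros => factor lam μ) ∧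
          Multipliable (fun μ : (spectralSet q l θ').zeros => factor lam μ) ∧
          Multipliable (fun μ : (spectralSetH q l θ h).zeros => factor lam μ) ∧
          Multipliable (fun μ : (spectralSetH q l θ' h).zeros => factor lam μ)) ∧
        ((spectralSet q l θ).delta lam = charFun q l θ lam ∧
          (spectralSet q l θ').delta lam = charFun q l θ' lam ∧
          (spectralSetH q l θ h).delta lam = charFunH q l θ h lam ∧
          (spectralSetH q l θ' h).delta lam = charFunH q l θ' h lam) ∧
        s q l 2 lam = recoverS2 (spectralSet q l θ) (spectralSet q l θ') lam ∧
        s q l 0 lam = recoverS0 (spectralSet q l θ) (spectralSet q l θ')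
          (spectralSetH q l θ h) (spectralSetH q l θ' h) lam) ∧
    (∀ q r : ℝ → ℝ, MemLp q 2 (volume.restrict (Ioo 0 l)) →
      MemLp r 2 (volume.restrict (Ioo 0 l)) →
      (spectralSetH q l θ h).Admissible → (spectralSetH q l θ' h).Admissible →
      spectralSet q l θ = spectralSet r l θ → spectralSet q l θ' = spectralSet r l θ' →
      spectralSetH q l θ h = spectralSetH r l θ h →
      spectralSetH q l θ' h = spectralSetH r l θ' h →
      ∀ lam : ℂ, s q l 2 lam = s r l 2 lam ∧ s q l 0 lam = s r l 0 lam) :=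
  have hL1 : ∀ q : ℝ → ℝ, MemLp q 2 (volume.restrict (Ioo 0 l)) →
      IntervalIntegrable q volume 0 l := fun _ hq =>
    (intervalIntegrable_iff_integrableOn_Ioo_of_le hl.le).2 (hq.integrable one_le_two)
  have hgen := lemma4p1_general l hl θ θ' hθ hθ' hne h hh
  ⟨fun q hq => hgen.1 q (hL1 q hq), fun q r hq hr => hgen.2 q r (hL1 q hq) (hL1 r hr)⟩
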